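/- **Setting.** Let $\mathcal D=\{(\mathbf x_i,y_i,a_i)\}_{i=1}^n$ with $C$ labels and $A$ attributes, and let $\mathcal P_i=\{j: y_j=y_i,\ a_j\ne a_i\}$, assumed non-empty for every $i$. Model weights are $w=[w_f,w_c]$. Let $z_i(w_f)=F(w_f,\mathbf x_i)/\|F(w_f,\mathbf x_i)\|$ be the normalized embeddings, $\ell_j(w)$ the per-sample losses, and $\tau\ge\tau_0>0$. The trainable parameter is $w_c$, with $w_f$ fixed (RAAN), or all of $w$ (RL-RAAN); below, $w$ denotes the trainable parameter, $d$ its dimension, and all gradients, Lipschitz and smoothness properties are with respect to it. Put $$g(w;\mathbf x_i,\mathbf x_j)=\tfrac{n}{AC}\,\mathbb I(j\in\mathcal P_i)\,e^{z_i^\top z_j/\tau}\,[\ell_j(w),\,1]^\top,\quad g_i(w)=\tfrac1{|\mathcal P_i|}\sum_{j\in\mathcal P_i}g(w;\mathbf x_i,\mathbf x_j),\quad f(u)=\tfrac{u_1}{u_2},\quad R(w)=\tfrac1n\sum_{i=1}^n f(g_i(w)).$$ **Assumptions.** (a) $R(w_1)-\inf_w R(w)\le\Delta_1$. (b) For every $j$,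 $|\ell_j|\le M$ and $\ell_j$ is $C_\ell$-Lipschitz and $L_\ell$-smooth. (c) There is $V$ with $\frac1n\sum_{j=1}^n\|g(w;\mathbf x_i,\mathbf x_j)-g_i(w)\|^2\le V$ and $\frac1n\sum_{j=1}^n\|\nabla g(w;\mathbf x_i,\mathbf x_j)-\nabla g_i(w)\|^2\le V$ for all $i,w$. (d) For every $i$ and $j\in\mathcal P_i$, the similarity $z_i^\top z_j$ is $C_s$-Lipschitz and $L_s$-smooth in the trainable parameter (automatic for RAAN). **Algorithm (SCRAAN).** For a non-empty set $S$ of indices write $\hat g_i(w;S)=\frac1{|S|}\sum_{j\in S}g(w;\mathbf x_i,\mathbf x_j)$. Start at $w_1$, with $u_i=\hat g_i(w_1;S_i)$ for some non-empty $S_i\subseteq\mathcal P_i$. At iteration $t$ draw, independently of the past, a set $\mathcal B$ of $B\ge1$ indices, each index belonging to $\mathcal B$ with probability $B/n$, and for each $i\in\mathcal B$ a non-empty $\hat{\mathcal P}_i\subseteq\mathcal P_i$ such that, given $i\in\mathcal B$, a uniformly chosen element of $\hat{\mathcal P}_i$ is uniform on $\mathcal P_i$. (Examples: $B=1$, $i$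 uniform on $\mathcal D$ and one uniform neighbour from $\mathcal P_i$; or $\mathcal B$ a uniform $B$-subset and $\hat{\mathcal P}_i=\mathcal P_i\cap\mathcal B$ when these are never empty.) With $\hat g_i=\hat g_i(\,\cdot\,;\hat{\mathcal P}_i)$, for $i\in\mathcal B$ set $$u_i^1\leftarrow(1-\gamma)u_i^1+\gamma[\hat g_i(w_t)]_1,\qquad u_i^2\leftarrow\max\big((1-\gamma)u_i^2+\gamma[\hat g_i(w_t)]_2,\ u_0\big),$$ leave the other $u_i$ unchanged, and then put $$G_t=\frac1B\sum_{i\in\mathcal B}\Big(\frac{\nabla[\hat g_i(w_t)]_1}{u_i^2}-\frac{u_i^1\,\nabla[\hat g_i(w_t)]_2}{(u_i^2)^2}\Big).$$ Here $u_0>0$ is a constant with $u_0\le[g_i(w)]_2$ for all $i,w$. The update is either * SGD: $w_{t+1}=w_t-\alpha G_t$; or * AMSGrad (coordinatewise): $h_{t+1}=\eta_1h_t+(1-\eta_1)G_t$, $v_{t+1}=\eta_2\hat v_t+(1-\eta_2)G_t^2$, $\hat v_{t+1}=\max(\hat v_t,v_{t+1})$, $w_{t+1}=w_t-\alpha h_{t+1}/\sqrt{\epsilon+\hat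 v_{t+1}}$, with $\epsilon>0$, $h_1=0$, and $\hat v_1\in[0,b]^d$. **Theorem.** Let $T>n$, $\alpha=\frac1{n^{2/5}T^{3/5}}$, $\gamma=\frac{n^{2/5}}{T^{2/5}}$ and, for AMSGrad, $0\le\eta_1\le\sqrt{\eta_2}\le1$ with $\eta_2\ge0$ and $\eta_1<1$. Then, for RAAN and for RL-RAAN and with either update, $$\mathbb E\Big[\frac1T\sum_{t=1}^T\|\nabla R(w_t)\|^2\Big]\le K\,\frac{n^{2/5}}{T^{2/5}}.$$ For SGD, $K$ depends only on $\Delta_1,M,C_\ell,L_\ell,C_s,L_s,\tau_0$; for AMSGrad it may depend in addition on $\eta_1,\eta_2,\epsilon,b$ and the dimensions of $w_f$ and $w_c$. In particular $K$ does not depend on $n,T,B,A,C,V,u_0$ or the data. -/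

import Mathlib

open MeasureTheory ProbabilityTheory
open scoped NNReal

noncomputable section

/-- Which of the two objectives is optimized: `raan wf` keeps the feature parameters fixed at `wf`
and trains the classification head only; `rlraan` trains all parameters. -/
inductive Variant (df dc : ℕ) : Type
  | raan (wf : EuclideanSpace ℝ (Fin df)) : Variant df dc
  | rlraan : Variant df dc

namespace Variant

variable {df dc : ℕ}

/-- Index set of the coordinates of the trainable parameter. -/
def Idx : Variant df dc → Type
  | raan _ => Fin dc
  | rlraan => Fin df ⊕ Fin dc

instance instFintypeIdx (s : Variant df dc) : Fintype s.Idx :=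
  match s with
  | raan _ => inferInstanceAs (Fintype (Fin dc))
  | rlraan => inferInstanceAs (Fintype (Fin df ⊕ Fin dc))

/-- The feature part `w_f` of the model weights for a value of the trainable parameter. -/
def feat : (s : Variant df dc) → EuclideanSpace ℝ s.Idx → EuclideanSpace ℝ (Fin df)
  | raan wf, _ => wf
  | rlraan, w => WithLp.toLp 2 fun i => w (Sum.inl i)

/-- The classification-head part `w_c` of the model weights. -/
def head : (s : Variant df dc) → EuclideanSpace ℝ s.Idx → EuclideanSpace ℝ (Fin dc)
  | raan _, w => w
  | rlraan, w => WithLp.toLp 2 fun i => w (Sum.inr i)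

end Variant

/-- An instance: `n` labelled samples with a sensitive attribute (`C` labels, `A` attributes),
a feature encoder, a per-sample loss, the temperature, and the choice RAAN / RL-RAAN. -/
structure Problem (𝒳 : Type*) (df dc m C A n : ℕ) where
  x : Fin n → 𝒳
  y : Fin n → Fin C
  a : Fin n → Fin A
  encoder : EuclideanSpace ℝ (Fin df) → 𝒳 → EuclideanSpace ℝ (Fin m)
  loss : EuclideanSpace ℝ (Fin df) → EuclideanSpace ℝ (Fin dc) → 𝒳 → Fin C → Fin A → ℝ
  τ : ℝ
  variant : Variant df dc

/-- The random choice made in one iteration: the sampled indices `anchors` and, for each sampled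
index `i`, the stochastic neighbourhood `nbrs i`. -/
structure Batch (n : ℕ) where
  anchors : Finset (Fin n)
  nbrs : Fin n → Finset (Fin n)

instance instMeasurableSpaceBatch (n : ℕ) : MeasurableSpace (Batch n) := ⊤

/-- SGD-style or AMSGrad-style parameter update. -/
inductive UpdateRule : Type
  | sgd : UpdateRule
  | amsgrad (η₁ η₂ ε : ℝ) : UpdateRule

/-- The outer function `f(u) = u₁ / u₂`. -/
def outer (u : EuclideanSpace ℝ (Fin 2)) : ℝ := u 0 / u 1

namespace Problem

variable {𝒳 : Type*} {df dc m C A n : ℕ} (P : Problem 𝒳 df dc m C A n)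

/-- The space of the trainable parameter. -/
abbrev Param : Type := EuclideanSpace ℝ P.variant.Idx

/-- The adversarial attribute neighbourhood `𝒫ᵢ`: same label, different attribute. -/
def nbr (i : Fin n) : Finset (Fin n) :=
  Finset.univ.filter fun j => P.y j = P.y i ∧ P.a j ≠ P.a i

/-- The normalized embedding `zᵢ = F(w_f, xᵢ) / ‖F(w_f, xᵢ)‖`. -/
def emb (i : Fin n) (w : P.Param) : EuclideanSpace ℝ (Fin m) :=
  ‖P.encoder (P.variant.feat w) (P.x i)‖⁻¹ • P.encoder (P.variant.feat w) (P.x i)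

/-- The similarity `zᵢᵀ zⱼ`. -/
def sim (i j : Fin n) (w : P.Param) : ℝ := inner ℝ (P.emb i w) (P.emb j w)

/-- The loss `ℓⱼ` of sample `j`. -/
def lossAt (j : Fin n) (w : P.Param) : ℝ :=
  P.loss (P.variant.feat w) (P.variant.head w) (P.x j) (P.y j) (P.a j)

/-- The pairwise inner function `g(w; xᵢ, xⱼ)`. -/
def gpair (i j : Fin n) (w : P.Param) : EuclideanSpace ℝ (Fin 2) :=
  if j ∈ P.nbr i then
    ((n : ℝ) / ((A : ℝ) * (C : ℝ))) •
      !₂[Real.exp (P.sim i j w / P.τ) * P.lossAt j w, Real.exp (P.sim i j w / P.τ)]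
  else 0

/-- The average of `g(w; xᵢ, xⱼ)` over `j ∈ S`: the stochastic estimator of `gᵢ(w)`. -/
def ghat (i : Fin n) (S : Finset (Fin n)) (w : P.Param) : EuclideanSpace ℝ (Fin 2) :=
  (S.card : ℝ)⁻¹ • ∑ j ∈ S, P.gpair i j w

/-- The inner function `gᵢ(w) = 𝔼_{j ∈ 𝒫ᵢ} g(w; xᵢ, xⱼ)`. -/
def g (i : Fin n) (w : P.Param) : EuclideanSpace ℝ (Fin 2) := P.ghat i (P.nbr i) w

/-- The compositional objective `R(w) = (1/n) ∑ᵢ f(gᵢ(w))`. -/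
def R (w : P.Param) : ℝ := (n : ℝ)⁻¹ * ∑ i, outer (P.g i w)

/-- The assumptions on the initial gap, the losses, and the variance of the inner functions. -/
structure Assumption (w₁ : P.Param) (Δ₁ M : ℝ) (Cl Ll : ℝ≥0) (V : ℝ) : Prop where
  gap : ∀ w, P.R w₁ - P.R w ≤ Δ₁
  loss_bdd : ∀ j w, |P.lossAt j w| ≤ M
  loss_lip : ∀ j, LipschitzWith Cl (P.lossAt j)
  loss_diff : ∀ j, Differentiable ℝ (P.lossAt j)
  loss_smooth : ∀ j, LipschitzWith Ll (gradient (P.lossAt j))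
  var_g : ∀ i w, (n : ℝ)⁻¹ * ∑ j, ‖P.gpair i j w - P.g i w‖ ^ 2 ≤ V
  var_grad : ∀ i w,
    (n : ℝ)⁻¹ * ∑ j, ‖fderiv ℝ (P.gpair i j) w - fderiv ℝ (P.g i) w‖ ^ 2 ≤ V

/-- Every sample has a neighbour, and the similarities of neighbours are Lipschitz and smooth in
the trainable parameter (automatic for RAAN, where they are constant). -/
structure Regular (Cs Ls : ℝ≥0) : Prop where
  nbr_nonempty : ∀ i, (P.nbr i).Nonempty
  sim_lip : ∀ i, ∀ j ∈ P.nbr i, LipschitzWith Cs (P.sim i j)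
  sim_diff : ∀ i, ∀ j ∈ P.nbr i, Differentiable ℝ (P.sim i j)
  sim_smooth : ∀ i, ∀ j ∈ P.nbr i, LipschitzWith Ls (gradient (P.sim i j))

/-- The batch `β` consists of `B` uniformly sampled indices; each sampled index `i` comes with a
nonempty `𝒫̂ᵢ ⊆ 𝒫ᵢ` such that, given that `i` is sampled, an element drawn uniformly from `𝒫̂ᵢ`
is uniformly distributed on `𝒫ᵢ`. -/
structure IsUniformBatch {Ω : Type*} [MeasurableSpace Ω] (μ : Measure Ω) (B : ℕ)
    (β : Ω → Batch n) : Prop where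
  measurable : Measurable β
  card : ∀ ω, (β ω).anchors.card = B
  anchor_prob : ∀ i, μ.real {ω | i ∈ (β ω).anchors} = (B : ℝ) / n
  nbrs_valid : ∀ ω, ∀ i ∈ (β ω).anchors, (β ω).nbrs i ⊆ P.nbr i ∧ ((β ω).nbrs i).Nonempty
  nbrs_prob : ∀ i, ∀ j ∈ P.nbr i,
    ∫ ω, (if i ∈ (β ω).anchors ∧ j ∈ (β ω).nbrs i then (((β ω).nbrs i).card : ℝ)⁻¹ else 0) ∂μ
      = (B : ℝ) / n * ((P.nbr i).card : ℝ)⁻¹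

/-- The state of the algorithm: parameter, moving averages `uᵢ`, first moment, and running
maximum of the second moment (the last two are not used by SGD). -/
structure State where
  w : P.Param
  u : Fin n → EuclideanSpace ℝ (Fin 2)
  h : P.Param
  v : P.Param

/-- The moving-average update `UG` of the estimators of the inner functions. -/
def updateU (γ u₀ : ℝ) (b : Batch n) (w : P.Param) (u : Fin n → EuclideanSpace ℝ (Fin 2)) :
    Fin n → EuclideanSpace ℝ (Fin 2) := fun i =>
  if i ∈ b.anchors then
    !₂[(1 - γ) * u i 0 + γ * P.ghat i (b.nbrs i) w 0,
      max ((1 - γ) * u i 1 + γ * P.ghat i (b.nbrs i) w 1) u₀]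
  else u i

/-- The stochastic gradient estimator `G(w)`, computed from the updated `u`. -/
def estG (b : Batch n) (w : P.Param) (u : Fin n → EuclideanSpace ℝ (Fin 2)) : P.Param :=
  (b.anchors.card : ℝ)⁻¹ • ∑ i ∈ b.anchors,
    ((1 / u i 1) • gradient (fun w' => P.ghat i (b.nbrs i) w' 0) w
      + (-(u i 0) / (u i 1) ^ 2) • gradient (fun w' => P.ghat i (b.nbrs i) w' 1) w)

/-- One iteration of SCRAAN. -/
def step (rule : UpdateRule) (α γ u₀ : ℝ) (b : Batch n) (s : P.State) : P.State :=
  let u' := P.updateU γ u₀ b s.w s.u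
  let G := P.estG b s.w u'
  match rule with
  | .sgd => { w := s.w - α • G, u := u', h := s.h, v := s.v }
  | .amsgrad η₁ η₂ ε =>
    let h' : P.Param := η₁ • s.h + (1 - η₁) • G
    let v' : P.Param := WithLp.toLp 2 fun l => max (s.v l) (η₂ * s.v l + (1 - η₂) * (G l) ^ 2)
    { w := s.w - α • (WithLp.toLp 2 fun l => h' l / √(ε + v' l)), u := u', h := h', v := v' }

/-- The state before iteration `k + 1`, given the batches: `b k` is the one used in iteration
`k + 1`. The run starts at the parameter `w₁`, with `uᵢ` the mini-batch estimator of `gᵢ(w₁)` over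
`S i`, first moment `0` and second moment `v₁`. -/
def run (rule : UpdateRule) (α γ u₀ : ℝ) (w₁ v₁ : P.Param) (S : Fin n → Finset (Fin n))
    (b : ℕ → Batch n) : ℕ → P.State
  | 0 => { w := w₁, u := fun i => P.ghat i (S i) w₁, h := 0, v := v₁ }
  | k + 1 => P.step rule α γ u₀ (b k) (run rule α γ u₀ w₁ v₁ S b k)

/-- `(1/T) ∑_{t=1}^T ‖∇R(w_t)‖²` for SCRAAN with `α = 1/(n^{2/5} T^{3/5})` and
`γ = n^{2/5}/T^{2/5}`. -/
def avgSqGrad (rule : UpdateRule) (u₀ : ℝ) (w₁ v₁ : P.Param) (S : Fin n → Finset (Fin n))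
    (T : ℕ) (b : ℕ → Batch n) : ℝ :=
  (1 / (T : ℝ)) * ∑ k ∈ Finset.range T,
    ‖gradient P.R
      (P.run rule (1 / ((n : ℝ) ^ (2 / 5 : ℝ) * (T : ℝ) ^ (3 / 5 : ℝ)))
        ((n : ℝ) ^ (2 / 5 : ℝ) / (T : ℝ) ^ (2 / 5 : ℝ)) u₀ w₁ v₁ S b k).w‖ ^ 2

end Problem

end

/-! The factor `n / (A C)` cancels in the quotient `f` and in the gradient estimator, so everything
is expressed through the normalized averages `phat` and `qhat`. Similarities of unit vectors lie in
`[-1, 1]`, hence the exponential weights lie between `exp (-1/τ₀)` and `exp (1/τ₀)`. This gives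
bounds `K, D, L, c` independent of `n, A, C, u₀` and the data (`exists_good`), and makes `R` smooth
with a universal constant.

The estimator `G` is biased: its weights use moving averages that contain the same batch as its
gradients. The bias is controlled pathwise. Replacing the moving averages by the true inner
functions costs at most a multiple of the tracking error plus `O(γ)` (`quotient_gradient_ge`,
`descentPart_le`). What remains is a batch average of a function of pairs `(i, j)` fixed by the
past, and for such functions the sampling scheme is exactly unbiased (`integral_sum_mean`). Thus one
step decreases `R` in expectation by a multiple of `α ‖∇R‖²`, up to the mean squared tracking error
`merr`, terms in `γ²`, and smoothness errors.

An index is refreshed with probability `B / n`, and the noise of a refresh has conditional mean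
zero. So `merr` contracts by `1 - 2 δ` with `δ = γ B / (2 n)`, up to `O(δ γ)`; Young's inequality
gives back one `δ` to absorb the drift of the parameter, leaving an error `O(α² / δ)`
(`integral_merr_succ_le`).

Both updates are preconditioned momentum steps: SGD has momentum `0` and preconditioner `1`, while
AMSGrad's preconditioner is bounded above and below and decreases in each coordinate, so its total
change telescopes. The correlation of `∇R` with the preconditioned momentum satisfies a linear
recursion (`momentum_ge`). Summing the recursions (`average_le_of_recursions`) leaves the terms
`1/(αT)`, `α`, `1/T`, `γ`, `γ²`, `1/(δT)` and `α²/δ²`, each `O(n^{2/5} / T^{2/5})` for the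
prescribed step sizes (`step_size_bounds`). -/

noncomputable section

/-! ### Calculus of bounded functions with bounded, Lipschitz derivative. -/

/-- `f` is bounded by `K`, and its derivative exists, is bounded by `D` and is `L`-Lipschitz. -/
structure BddSmooth {E : Type*} [NormedAddCommGroup E] [NormedSpace ℝ E] (f : E → ℝ)
    (K D L : ℝ) : Prop where
  diff : Differentiable ℝ f
  bdd : ∀ x, |f x| ≤ K
  fderiv_bdd : ∀ x, ‖fderiv ℝ f x‖ ≤ D
  fderiv_lip : ∀ x y, ‖fderiv ℝ f x - fderiv ℝ f y‖ ≤ L * ‖x - y‖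

namespace BddSmooth

variable {E : Type*} [NormedAddCommGroup E] [NormedSpace ℝ E] {f g : E → ℝ}
  {K D L K₁ D₁ L₁ K₂ D₂ L₂ : ℝ}

lemma nonneg_bdd (h : BddSmooth f K D L) : 0 ≤ K := (abs_nonneg _).trans (h.bdd 0)

lemma nonneg_fderiv_bdd (h : BddSmooth f K D L) : 0 ≤ D := (norm_nonneg _).trans (h.fderiv_bdd 0)

lemma mono (h : BddSmooth f K D L) (hK : K ≤ K₁) (hD : D ≤ D₁) (hL : L ≤ L₁) :
    BddSmooth f K₁ D₁ L₁ where
  diff := h.diff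
  bdd x := (h.bdd x).trans hK
  fderiv_bdd x := (h.fderiv_bdd x).trans hD
  fderiv_lip x y := (h.fderiv_lip x y).trans (by gcongr)

lemma abs_fderiv_apply_le (h : BddSmooth f K D L) (x v : E) : |fderiv ℝ f x v| ≤ D * ‖v‖ :=
  ((fderiv ℝ f x).le_opNorm v).trans (by gcongr; exact h.fderiv_bdd x)

lemma lip (h : BddSmooth f K D L) (x y : E) : |f x - f y| ≤ D * ‖x - y‖ :=
  Convex.norm_image_sub_le_of_norm_fderiv_le (𝕜 := ℝ) (fun z _ => h.diff z)
    (fun z _ => h.fderiv_bdd z) convex_univ (Set.mem_univ y) (Set.mem_univ x)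

lemma descent (h : BddSmooth f K D L) (hL : 0 ≤ L) (x y : E) :
    f y ≤ f x + fderiv ℝ f x (y - x) + L * ‖y - x‖ ^ 2 := by
  have := Convex.norm_image_sub_le_of_norm_fderiv_le' (𝕜 := ℝ) (f := f) (φ := fderiv ℝ f x)
    (C := L * ‖y - x‖) (s := segment ℝ x y) (fun z _ => h.diff z)
    (fun z hz => (h.fderiv_lip z x).trans (by
      gcongr
      exact norm_sub_le_of_mem_segment hz)) (convex_segment x y) (left_mem_segment ℝ x y)
    (right_mem_segment ℝ x y)
  rw [Real.norm_eq_abs] at this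
  nlinarith [le_abs_self (f y - f x - fderiv ℝ f x (y - x))]

/-- Chain rule with constants. The conditions on `φ` are imposed only at values of `f`, since `exp`
and the inverse have no global bounds. -/
lemma comp (h : BddSmooth f K D L) {φ φ' : ℝ → ℝ} {A B : ℝ} (hA : 0 ≤ A) (hB₀ : 0 ≤ B)
    (hφ : ∀ x, HasDerivAt φ (φ' (f x)) (f x)) (hK : ∀ x, |φ (f x)| ≤ K₁)
    (hφ' : ∀ x, |φ' (f x)| ≤ A) (hB : ∀ x y, |φ' (f x) - φ' (f y)| ≤ B * |f x - f y|) :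
    BddSmooth (fun x => φ (f x)) K₁ (A * D) (A * L + B * D ^ 2) := by
  have hd : ∀ x, HasFDerivAt (fun x => φ (f x)) (φ' (f x) • fderiv ℝ f x) x := fun x =>
    (hφ x).comp_hasFDerivAt x (h.diff x).hasFDerivAt
  have hD := h.nonneg_fderiv_bdd
  refine ⟨fun x => (hd x).differentiableAt, hK, fun x => ?_, fun x y => ?_⟩
  · rw [(hd x).fderiv, norm_smul]
    exact mul_le_mul (hφ' x) (h.fderiv_bdd x) (norm_nonneg _) hA
  · rw [(hd x).fderiv, (hd y).fderiv]
    have : φ' (f x) • fderiv ℝ f x - φ' (f y) • fderiv ℝ f y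
        = φ' (f x) • (fderiv ℝ f x - fderiv ℝ f y) + (φ' (f x) - φ' (f y)) • fderiv ℝ f y := by
      rw [smul_sub, sub_smul]; abel
    rw [this]
    refine (norm_add_le _ _).trans ?_
    rw [norm_smul, norm_smul, Real.norm_eq_abs, Real.norm_eq_abs]
    have h1 : |φ' (f x)| * ‖fderiv ℝ f x - fderiv ℝ f y‖ ≤ A * (L * ‖x - y‖) :=
      mul_le_mul (hφ' x) (h.fderiv_lip x y) (norm_nonneg _) hA
    have h2 : |φ' (f x) - φ' (f y)| * ‖fderiv ℝ f y‖ ≤ (B * D * ‖x - y‖) * D := by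
      refine mul_le_mul ?_ (h.fderiv_bdd y) (norm_nonneg _) ?_
      · exact (hB x y).trans (by rw [mul_assoc]; gcongr; exact h.lip x y)
      · positivity
    nlinarith

lemma exp (h : BddSmooth f K D L) :
    BddSmooth (fun x => Real.exp (f x)) (Real.exp K) (Real.exp K * D)
      (Real.exp K * L + Real.exp K * D ^ 2) := by
  have hle : ∀ x, Real.exp (f x) ≤ Real.exp K := fun x =>
    Real.exp_le_exp.2 ((le_abs_self _).trans (h.bdd x))
  have habs : ∀ x, |Real.exp (f x)| ≤ Real.exp K := fun x => by
    rw [abs_of_pos (Real.exp_pos _)]; exact hle x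
  refine h.comp (φ' := Real.exp) (Real.exp_pos K).le (Real.exp_pos K).le
    (fun x => Real.hasDerivAt_exp _) habs habs fun x y => ?_
  exact Convex.norm_image_sub_le_of_norm_hasDerivWithin_le (𝕜 := ℝ) (f := Real.exp)
    (f' := Real.exp) (s := Set.Iic K) (fun z _ => (Real.hasDerivAt_exp z).hasDerivWithinAt)
    (fun z hz => by
      rw [Real.norm_eq_abs, abs_of_pos (Real.exp_pos _)]; exact Real.exp_le_exp.2 hz)
    (convex_Iic K) ((le_abs_self _).trans (h.bdd y)) ((le_abs_self _).trans (h.bdd x))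

lemma inv (h : BddSmooth f K D L) {c : ℝ} (hc : 0 < c) (hf : ∀ x, c ≤ f x) :
    BddSmooth (fun x => (f x)⁻¹) c⁻¹ ((c ^ 2)⁻¹ * D)
      ((c ^ 2)⁻¹ * L + 2 / c ^ 3 * D ^ 2) := by
  have hpos : ∀ x, 0 < f x := fun x => hc.trans_le (hf x)
  refine h.comp (φ := fun t => t⁻¹) (φ' := fun t => -(t ^ 2)⁻¹) (by positivity) (by positivity)
    (fun x => hasDerivAt_inv (hpos x).ne') (fun x => ?_) (fun x => ?_) fun x y => ?_
  · rw [abs_of_pos (inv_pos.2 (hpos x))]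
    exact inv_anti₀ hc (hf x)
  · rw [abs_neg, abs_of_pos (by have := hpos x; positivity)]
    exact inv_anti₀ (by positivity) (pow_le_pow_left₀ hc.le (hf x) 2)
  · have hx := hpos x
    have hy := hpos y
    -- An exact difference quotient for `-1/t²`; each of its two summands is at most `1 / c ^ 3`.
    have e : -(f x ^ 2)⁻¹ - -(f y ^ 2)⁻¹
        = ((f x * f y ^ 2)⁻¹ + (f x ^ 2 * f y)⁻¹) * (f x - f y) := by
      field_simp; ring
    rw [e, abs_mul, abs_of_pos (by positivity)]
    gcongr
    have h1 : (f x * f y ^ 2)⁻¹ ≤ (c * c ^ 2)⁻¹ := by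
      gcongr
      exacts [hf x, hf y]
    have h2 : (f x ^ 2 * f y)⁻¹ ≤ (c ^ 2 * c)⁻¹ := by
      gcongr
      exacts [hf x, hf y]
    have h3 : 2 / c ^ 3 = (c * c ^ 2)⁻¹ + (c ^ 2 * c)⁻¹ := by field_simp; ring
    rw [h3]
    exact add_le_add h1 h2

lemma mul (hf : BddSmooth f K₁ D₁ L₁) (hg : BddSmooth g K₂ D₂ L₂) :
    BddSmooth (fun x => f x * g x) (K₁ * K₂) (K₁ * D₂ + K₂ * D₁)
      (K₁ * L₂ + K₂ * L₁ + 2 * (D₁ * D₂)) := by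
  have hd : ∀ x, HasFDerivAt (fun x => f x * g x) (f x • fderiv ℝ g x + g x • fderiv ℝ f x) x :=
    fun x => (hf.diff x).hasFDerivAt.mul (hg.diff x).hasFDerivAt
  have hK₁ := hf.nonneg_bdd
  have hK₂ := hg.nonneg_bdd
  have hD₁ := hf.nonneg_fderiv_bdd
  have hD₂ := hg.nonneg_fderiv_bdd
  refine ⟨fun x => (hd x).differentiableAt, fun x => ?_, fun x => ?_, fun x y => ?_⟩
  · rw [abs_mul]
    exact mul_le_mul (hf.bdd x) (hg.bdd x) (abs_nonneg _) hK₁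
  · rw [(hd x).fderiv]
    refine (norm_add_le _ _).trans ?_
    rw [norm_smul, norm_smul]
    exact add_le_add (mul_le_mul (hf.bdd x) (hg.fderiv_bdd x) (norm_nonneg _) hK₁)
      (mul_le_mul (hg.bdd x) (hf.fderiv_bdd x) (norm_nonneg _) hK₂)
  · rw [(hd x).fderiv, (hd y).fderiv]
    have e : f x • fderiv ℝ g x + g x • fderiv ℝ f x - (f y • fderiv ℝ g y + g y • fderiv ℝ f y)
        = (f x • (fderiv ℝ g x - fderiv ℝ g y) + g x • (fderiv ℝ f x - fderiv ℝ f y))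
          + ((f x - f y) • fderiv ℝ g y + (g x - g y) • fderiv ℝ f y) := by
      simp only [smul_sub, sub_smul]; abel
    rw [e]
    refine (norm_add_le _ _).trans ((add_le_add (norm_add_le _ _) (norm_add_le _ _)).trans ?_)
    simp only [norm_smul]
    have h1 := mul_le_mul (hf.bdd x) (hg.fderiv_lip x y) (norm_nonneg _) hK₁
    have h2 := mul_le_mul (hg.bdd x) (hf.fderiv_lip x y) (norm_nonneg _) hK₂
    have h3 := mul_le_mul (hf.lip x y) (hg.fderiv_bdd y) (norm_nonneg _) (by positivity)
    have h4 := mul_le_mul (hg.lip x y) (hf.fderiv_bdd y) (norm_nonneg _) (by positivity)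
    simp only [Real.norm_eq_abs]
    linarith

lemma const_mul (h : BddSmooth f K D L) (a : ℝ) :
    BddSmooth (fun x => a * f x) (|a| * K) (|a| * D) (|a| * L) := by
  have hd : ∀ x, HasFDerivAt (fun x => a * f x) (a • fderiv ℝ f x) x :=
    fun x => (h.diff x).hasFDerivAt.const_mul a
  refine ⟨fun x => (hd x).differentiableAt, fun x => ?_, fun x => ?_, fun x y => ?_⟩
  · rw [abs_mul]
    gcongr
    exact h.bdd x
  · rw [(hd x).fderiv, norm_smul, Real.norm_eq_abs]
    gcongr
    exact h.fderiv_bdd x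
  · rw [(hd x).fderiv, (hd y).fderiv, ← smul_sub, norm_smul, Real.norm_eq_abs, mul_assoc]
    gcongr
    exact h.fderiv_lip x y

end BddSmooth

/-! ### Finite averages and their derivatives. -/

/-- The arithmetic mean of `f` over `S`. -/
def mean {α : Type*} (S : Finset α) (f : α → ℝ) : ℝ := (S.card : ℝ)⁻¹ * ∑ j ∈ S, f j

section mean

variable {α : Type*} {S : Finset α} {f g : α → ℝ}

lemma mean_le_mean (h : ∀ j ∈ S, f j ≤ g j) : mean S f ≤ mean S g :=
  mul_le_mul_of_nonneg_left (Finset.sum_le_sum h) (by positivity)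

lemma mean_add : mean S (fun j => f j + g j) = mean S f + mean S g := by
  simp only [mean, Finset.sum_add_distrib, mul_add]

lemma mean_sub : mean S (fun j => f j - g j) = mean S f - mean S g := by
  simp only [mean, Finset.sum_sub_distrib, mul_sub]

lemma mean_const_mul (a : ℝ) : mean S (fun j => a * f j) = a * mean S f := by
  simp only [mean, ← Finset.mul_sum]; ring

lemma mean_const (hS : S.Nonempty) (a : ℝ) : mean S (fun _ => a) = a := by
  have : (S.card : ℝ) ≠ 0 := by exact_mod_cast hS.card_pos.ne'
  simp only [mean, Finset.sum_const, nsmul_eq_mul]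
  field_simp

lemma le_mean (hS : S.Nonempty) {a : ℝ} (h : ∀ j ∈ S, a ≤ f j) : a ≤ mean S f :=
  (mean_const hS a).symm.le.trans (mean_le_mean h)

lemma mean_le (hS : S.Nonempty) {a : ℝ} (h : ∀ j ∈ S, f j ≤ a) : mean S f ≤ a :=
  (mean_le_mean h).trans (mean_const hS a).le

lemma abs_mean_le : |mean S f| ≤ mean S (fun j => |f j|) := by
  rw [mean, mean, abs_mul, abs_of_nonneg (by positivity)]
  gcongr
  exact Finset.abs_sum_le_sum_abs _ _

variable {E : Type*} [NormedAddCommGroup E] [NormedSpace ℝ E] {F : α → E → ℝ} {K D L : ℝ}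

lemma hasFDerivAt_mean {x : E} (h : ∀ j ∈ S, DifferentiableAt ℝ (F j) x) :
    HasFDerivAt (fun x => mean S fun j => F j x) ((S.card : ℝ)⁻¹ • ∑ j ∈ S, fderiv ℝ (F j) x) x :=
  (HasFDerivAt.fun_sum fun j hj => (h j hj).hasFDerivAt).const_mul _

lemma fderiv_mean_apply {x : E} (h : ∀ j ∈ S, DifferentiableAt ℝ (F j) x) (v : E) :
    fderiv ℝ (fun x => mean S fun j => F j x) x v = mean S fun j => fderiv ℝ (F j) x v := by
  rw [(hasFDerivAt_mean h).fderiv]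
  simp [mean]

lemma BddSmooth.mean (hS : S.Nonempty) (h : ∀ j ∈ S, BddSmooth (F j) K D L) :
    BddSmooth (fun x => mean S fun j => F j x) K D L := by
  have hd : ∀ x, _ := fun x => hasFDerivAt_mean (x := x) fun j hj => (h j hj).diff x
  have hmean : ∀ (G : α → E →L[ℝ] ℝ) (a : ℝ), (∀ j ∈ S, ‖G j‖ ≤ a) →
      ‖(S.card : ℝ)⁻¹ • ∑ j ∈ S, G j‖ ≤ a := fun G a hG => by
    rw [norm_smul, Real.norm_of_nonneg (by positivity)]
    refine le_trans ?_ (mean_le hS hG)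
    unfold _root_.mean
    gcongr
    exact norm_sum_le _ _
  refine ⟨fun x => (hd x).differentiableAt, fun x => ?_, fun x => ?_, fun x y => ?_⟩
  · exact abs_mean_le.trans (mean_le hS fun j hj => (h j hj).bdd x)
  · rw [(hd x).fderiv]
    exact hmean _ _ fun j hj => (h j hj).fderiv_bdd x
  · rw [(hd x).fderiv, (hd y).fderiv, ← smul_sub, ← Finset.sum_sub_distrib]
    exact hmean _ _ fun j hj => (h j hj).fderiv_lip x y

end mean

/-! ### Coordinatewise preconditioners. -/

/-- Coordinatewise scaling of a vector. -/
def diag {ι : Type*} (d : ι → ℝ) (x : EuclideanSpace ℝ ι) : EuclideanSpace ℝ ι :=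
  WithLp.toLp 2 fun l => d l * x l

section diag

variable {ι : Type*} [Fintype ι] {d d' : ι → ℝ} (x y : EuclideanSpace ℝ ι)

lemma inner_diag_right : inner ℝ x (diag d y) = ∑ l, d l * (x l * y l) := by
  simp only [diag, PiLp.inner_apply, RCLike.inner_apply, conj_trivial]
  exact Finset.sum_congr rfl fun l _ => by ring

lemma inner_diag_left : inner ℝ (diag d x) y = inner ℝ x (diag d y) := by
  rw [real_inner_comm, inner_diag_right, inner_diag_right]
  exact Finset.sum_congr rfl fun l _ => by ring

lemma norm_diag_le {Λ : ℝ} (h₀ : ∀ l, 0 ≤ d l) (hd : ∀ l, d l ≤ Λ) (hΛ : 0 ≤ Λ) :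
    ‖diag d x‖ ≤ Λ * ‖x‖ := by
  rw [← sq_le_sq₀ (norm_nonneg _) (by positivity), mul_pow, EuclideanSpace.real_norm_sq_eq,
    EuclideanSpace.real_norm_sq_eq, Finset.mul_sum]
  refine Finset.sum_le_sum fun l _ => ?_
  change (d l * x l) ^ 2 ≤ _
  rw [mul_pow]
  have := h₀ l
  gcongr
  exact hd l

lemma le_inner_diag_self {lo : ℝ} (hd : ∀ l, lo ≤ d l) :
    lo * ‖x‖ ^ 2 ≤ inner ℝ x (diag d x) := by
  rw [inner_diag_right, EuclideanSpace.real_norm_sq_eq, Finset.mul_sum]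
  refine Finset.sum_le_sum fun l _ => ?_
  rw [← sq]
  gcongr
  exact hd l

/-- For ordered preconditioners the change is measured by a difference of traces, which telescopes
along a decreasing sequence. -/
lemma inner_diag_sub_le (hd : ∀ l, d' l ≤ d l) :
    inner ℝ x (diag d y) - inner ℝ x (diag d' y) ≤ ‖x‖ * ‖y‖ * (∑ l, d l - ∑ l, d' l) := by
  rw [inner_diag_right, inner_diag_right, ← Finset.sum_sub_distrib, ← Finset.sum_sub_distrib,
    Finset.mul_sum]
  refine Finset.sum_le_sum fun l _ => ?_
  have hx := PiLp.norm_apply_le x l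
  have hy := PiLp.norm_apply_le y l
  have : x l * y l ≤ ‖x‖ * ‖y‖ := by
    refine (le_abs_self _).trans ?_
    rw [abs_mul]
    exact mul_le_mul hx hy (abs_nonneg _) (norm_nonneg _)
  nlinarith [hd l]

end diag

/-! ### Normalized inner functions and instance-independent constants. -/

namespace Problem

variable {𝒳 : Type*} {df dc m C A n : ℕ} (P : Problem 𝒳 df dc m C A n)

/-- The normalization factor `n / (A C)` of the pairwise inner functions. -/
def scale (_ : Problem 𝒳 df dc m C A n) : ℝ := (n : ℝ) / ((A : ℝ) * (C : ℝ))

/-- First coordinate of the pairwise inner function, without the factor `n / (A C)`. -/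
def pw (i j : Fin n) (w : P.Param) : ℝ :=
  if j ∈ P.nbr i then Real.exp (P.sim i j w / P.τ) * P.lossAt j w else 0

/-- Second coordinate of the pairwise inner function, without the factor `n / (A C)`. -/
def qw (i j : Fin n) (w : P.Param) : ℝ :=
  if j ∈ P.nbr i then Real.exp (P.sim i j w / P.τ) else 0

/-- The average of `pw` over `S`. -/
def phat (i : Fin n) (S : Finset (Fin n)) (w : P.Param) : ℝ := mean S fun j => P.pw i j w

/-- The average of `qw` over `S`. -/
def qhat (i : Fin n) (S : Finset (Fin n)) (w : P.Param) : ℝ := mean S fun j => P.qw i j w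

lemma ghat_zero (i : Fin n) (S : Finset (Fin n)) (w : P.Param) :
    P.ghat i S w 0 = P.scale * P.phat i S w := by
  have : ∀ j, P.gpair i j w 0 = P.scale * P.pw i j w := fun j => by
    unfold gpair pw scale
    split_ifs <;> simp
  simp only [ghat, phat, PiLp.smul_apply, WithLp.ofLp_sum, Finset.sum_apply, this, smul_eq_mul,
    mean, ← Finset.mul_sum]
  ring

lemma ghat_one (i : Fin n) (S : Finset (Fin n)) (w : P.Param) :
    P.ghat i S w 1 = P.scale * P.qhat i S w := by
  have : ∀ j, P.gpair i j w 1 = P.scale * P.qw i j w := fun j => by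
    unfold gpair qw scale
    split_ifs <;> simp
  simp only [ghat, qhat, PiLp.smul_apply, WithLp.ofLp_sum, Finset.sum_apply, this, smul_eq_mul,
    mean, ← Finset.mul_sum]
  ring

lemma scale_pos (hn : 0 < n) : 0 < P.scale := by
  have hC : 0 < C := Fin.pos (P.y ⟨0, hn⟩)
  have hA : 0 < A := Fin.pos (P.a ⟨0, hn⟩)
  unfold scale
  positivity

/-- Boundedness and smoothness of the normalized inner functions, with constants that do not
depend on the instance. -/
structure Good (K D L c : ℝ) : Prop where
  c_pos : 0 < c
  L_nonneg : 0 ≤ L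
  nbr_nonempty : ∀ i, (P.nbr i).Nonempty
  pw_smooth : ∀ i, ∀ j ∈ P.nbr i, BddSmooth (P.pw i j) K D L
  qw_smooth : ∀ i, ∀ j ∈ P.nbr i, BddSmooth (P.qw i j) K D L
  le_qw : ∀ i, ∀ j ∈ P.nbr i, ∀ w, c ≤ P.qw i j w

lemma norm_emb_le (i : Fin n) (w : P.Param) : ‖P.emb i w‖ ≤ 1 := by
  rw [emb, norm_smul, norm_inv, norm_norm]
  exact inv_mul_le_one

lemma abs_sim_le (i j : Fin n) (w : P.Param) : |P.sim i j w| ≤ 1 :=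
  (abs_real_inner_le_norm _ _).trans
    (mul_le_one₀ (P.norm_emb_le i w) (norm_nonneg _) (P.norm_emb_le j w))

end Problem

lemma BddSmooth.of_gradient {E : Type*} [NormedAddCommGroup E] [InnerProductSpace ℝ E]
    [CompleteSpace E] {f : E → ℝ} {K : ℝ} {D L : ℝ≥0} (hf : Differentiable ℝ f)
    (hK : ∀ x, |f x| ≤ K) (hD : LipschitzWith D f) (hL : LipschitzWith L (gradient f)) :
    BddSmooth f K D L := by
  refine ⟨hf, hK, fun x => norm_fderiv_le_of_lipschitz ℝ hD, fun x y => ?_⟩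
  rw [← toDual_gradient, ← toDual_gradient, ← map_sub, LinearIsometryEquiv.norm_map]
  exact hL.norm_sub_le x y

/-- The exponent is bounded by `1/τ₀` because embeddings have norm at most one, so the exponential
is bounded above and away from zero. The constants are chosen before the instance, which is what
makes the final rate uniform. Each maximum covers the numerator and the denominator with one
constant. -/
lemma exists_good (M τ₀ : ℝ) (Cl Ll Cs Ls : ℝ≥0) (hτ₀ : 0 < τ₀) :
    ∃ K D L c : ℝ, ∀ {𝒳 : Type*} {df dc m C A n : ℕ} (P : Problem 𝒳 df dc m C A n)
      (w₁ : P.Param) (Δ₁ V : ℝ), τ₀ ≤ P.τ → P.Assumption w₁ Δ₁ M Cl Ll V → P.Regular Cs Ls →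
        P.Good K D L c := by
  set E := Real.exp τ₀⁻¹
  set D₀ : ℝ := E * (τ₀⁻¹ * Cs)
  set L₀ : ℝ := E * (τ₀⁻¹ * Ls) + E * (τ₀⁻¹ * Cs) ^ 2
  refine ⟨max (E * M) E, max (E * Cl + M * D₀) D₀, max (E * Ll + M * L₀ + 2 * (D₀ * Cl)) L₀,
    Real.exp (-τ₀⁻¹), fun P w₁ Δ₁ V hτ hP hR => ?_⟩
  have hinv : P.τ⁻¹ ≤ τ₀⁻¹ := inv_anti₀ hτ₀ hτ
  have hτpos : 0 < P.τ := hτ₀.trans_le hτ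
  have hs : ∀ i, ∀ j ∈ P.nbr i, BddSmooth (fun w => P.τ⁻¹ * P.sim i j w) τ₀⁻¹ (τ₀⁻¹ * Cs)
      (τ₀⁻¹ * Ls) := fun i j hj => by
    have := (BddSmooth.of_gradient (hR.sim_diff i j hj) (P.abs_sim_le i j) (hR.sim_lip i j hj)
      (hR.sim_smooth i j hj)).const_mul P.τ⁻¹
    rw [abs_of_pos (inv_pos.2 hτpos)] at this
    refine this.mono ?_ ?_ ?_
    · rwa [mul_one]
    · gcongr
    · gcongr
  have hq : ∀ i, ∀ j ∈ P.nbr i, P.qw i j = fun w => Real.exp (P.τ⁻¹ * P.sim i j w) :=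
    fun i j hj => by
      funext w
      rw [Problem.qw, if_pos hj, div_eq_inv_mul]
  have hp : ∀ i, ∀ j ∈ P.nbr i,
      P.pw i j = fun w => Real.exp (P.τ⁻¹ * P.sim i j w) * P.lossAt j w :=
    fun i j hj => by
      funext w
      rw [Problem.pw, if_pos hj, div_eq_inv_mul]
  refine ⟨Real.exp_pos _, le_max_of_le_right (by positivity), hR.nbr_nonempty,
    fun i j hj => ?_, fun i j hj => ?_, fun i j hj w => ?_⟩
  · rw [hp i j hj]
    exact ((hs i j hj).exp.mul (BddSmooth.of_gradient (hP.loss_diff j) (hP.loss_bdd j)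
      (hP.loss_lip j) (hP.loss_smooth j))).mono (le_max_left _ _) (le_max_left _ _)
      (le_max_left _ _)
  · rw [hq i j hj]
    exact (hs i j hj).exp.mono (le_max_right _ _) (le_max_right _ _) (le_max_right _ _)
  · rw [hq i j hj]
    exact Real.exp_le_exp.2 (neg_le_of_abs_le ((hs i j hj).bdd w))

/-! ### The objective and the gradient estimator in normalized form. -/

namespace Problem

variable {𝒳 : Type*} {df dc m C A n : ℕ} {P : Problem 𝒳 df dc m C A n} {K D L c : ℝ}

/-- The averages of the batch `β` estimate the inner functions. -/
structure Valid (P : Problem 𝒳 df dc m C A n) (β : Batch n) : Prop where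
  anchors_nonempty : β.anchors.Nonempty
  subset : ∀ i ∈ β.anchors, β.nbrs i ⊆ P.nbr i
  nonempty : ∀ i ∈ β.anchors, (β.nbrs i).Nonempty

/-- The gradient estimator in terms of the normalized inner functions and moving averages. -/
def gest (P : Problem 𝒳 df dc m C A n) (β : Batch n) (w : P.Param) (a b : Fin n → ℝ) : P.Param :=
  (β.anchors.card : ℝ)⁻¹ • ∑ i ∈ β.anchors,
    ((1 / b i) • gradient (P.phat i (β.nbrs i)) w
      + (-(a i) / (b i) ^ 2) • gradient (P.qhat i (β.nbrs i)) w)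

/-- Squared error of the `i`-th moving average. -/
def err (P : Problem 𝒳 df dc m C A n) (w : P.Param) (a b : Fin n → ℝ) (i : Fin n) : ℝ :=
  (a i - P.phat i (P.nbr i) w) ^ 2 + (b i - P.qhat i (P.nbr i) w) ^ 2

/-- Mean squared error of the moving averages. -/
def merr (P : Problem 𝒳 df dc m C A n) (w : P.Param) (a b : Fin n → ℝ) : ℝ :=
  mean Finset.univ (P.err w a b)

lemma inner_gest (β : Batch n) (w v : P.Param) (a b : Fin n → ℝ) :
    inner ℝ v (P.gest β w a b) = mean β.anchors fun i =>
      1 / b i * fderiv ℝ (P.phat i (β.nbrs i)) w v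
        - a i / (b i) ^ 2 * fderiv ℝ (P.qhat i (β.nbrs i)) w v := by
  rw [gest, real_inner_smul_right, inner_sum, mean]
  congr 1
  refine Finset.sum_congr rfl fun i _ => ?_
  rw [inner_add_right, real_inner_smul_right, real_inner_smul_right, inner_gradient_right,
    inner_gradient_right, conj_trivial, conj_trivial]
  ring

namespace Good

lemma phat_smooth (hP : P.Good K D L c) {i : Fin n} {S : Finset (Fin n)} (hS : S ⊆ P.nbr i)
    (hne : S.Nonempty) : BddSmooth (P.phat i S) K D L :=
  BddSmooth.mean hne fun j hj => hP.pw_smooth i j (hS hj)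

lemma qhat_smooth (hP : P.Good K D L c) {i : Fin n} {S : Finset (Fin n)} (hS : S ⊆ P.nbr i)
    (hne : S.Nonempty) : BddSmooth (P.qhat i S) K D L :=
  BddSmooth.mean hne fun j hj => hP.qw_smooth i j (hS hj)

lemma le_qhat (hP : P.Good K D L c) {i : Fin n} {S : Finset (Fin n)} (hS : S ⊆ P.nbr i)
    (hne : S.Nonempty) (w : P.Param) : c ≤ P.qhat i S w :=
  le_mean hne fun j hj => hP.le_qw i j (hS hj) w

lemma fderiv_phat_apply (hP : P.Good K D L c) {i : Fin n} {S : Finset (Fin n)}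
    (hS : S ⊆ P.nbr i) (w v : P.Param) :
    fderiv ℝ (P.phat i S) w v = mean S fun j => fderiv ℝ (P.pw i j) w v :=
  fderiv_mean_apply (fun j hj => (hP.pw_smooth i j (hS hj)).diff w) v

lemma fderiv_qhat_apply (hP : P.Good K D L c) {i : Fin n} {S : Finset (Fin n)}
    (hS : S ⊆ P.nbr i) (w v : P.Param) :
    fderiv ℝ (P.qhat i S) w v = mean S fun j => fderiv ℝ (P.qw i j) w v :=
  fderiv_mean_apply (fun j hj => (hP.qw_smooth i j (hS hj)).diff w) v

/-- The quotient is homogeneous of degree zero, so the normalization factor drops out. -/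
lemma R_eq (hn : 0 < n) :
    P.R = fun w => mean Finset.univ fun i => P.phat i (P.nbr i) w * (P.qhat i (P.nbr i) w)⁻¹ := by
  funext w
  have := (P.scale_pos hn).ne'
  simp only [R, mean, outer, Finset.card_univ, Fintype.card_fin, g, ghat_zero, ghat_one,
    mul_div_mul_left _ _ this, div_eq_mul_inv]

lemma summand_smooth (hP : P.Good K D L c) (i : Fin n) :
    BddSmooth (fun w => P.phat i (P.nbr i) w * (P.qhat i (P.nbr i) w)⁻¹) (K * c⁻¹)
      (K * ((c ^ 2)⁻¹ * D) + c⁻¹ * D)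
      (K * ((c ^ 2)⁻¹ * L + 2 / c ^ 3 * D ^ 2) + c⁻¹ * L + 2 * (D * ((c ^ 2)⁻¹ * D))) :=
  (hP.phat_smooth le_rfl (hP.nbr_nonempty i)).mul
    ((hP.qhat_smooth le_rfl (hP.nbr_nonempty i)).inv hP.c_pos
      (hP.le_qhat le_rfl (hP.nbr_nonempty i)))

lemma R_smooth (hP : P.Good K D L c) (hn : 0 < n) :
    BddSmooth P.R (K * c⁻¹) (K * ((c ^ 2)⁻¹ * D) + c⁻¹ * D)
      (K * ((c ^ 2)⁻¹ * L + 2 / c ^ 3 * D ^ 2) + c⁻¹ * L + 2 * (D * ((c ^ 2)⁻¹ * D))) := by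
  rw [R_eq hn]
  have : Nonempty (Fin n) := ⟨⟨0, hn⟩⟩
  exact BddSmooth.mean Finset.univ_nonempty fun i _ => hP.summand_smooth i

/-- The quotient rule, arranged as an average over pairs `(i, j)` so that it can be matched with the
mean of a batch average. -/
lemma fderiv_R_apply (hP : P.Good K D L c) (hn : 0 < n) (w v : P.Param) :
    fderiv ℝ P.R w v = mean Finset.univ fun i => mean (P.nbr i) fun j =>
      1 / P.qhat i (P.nbr i) w * fderiv ℝ (P.pw i j) w v
        - P.phat i (P.nbr i) w / (P.qhat i (P.nbr i) w) ^ 2 * fderiv ℝ (P.qw i j) w v := by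
  rw [R_eq hn, fderiv_mean_apply fun i _ => (hP.summand_smooth i).diff w]
  congr 1
  funext i
  rw [mean_sub, mean_const_mul, mean_const_mul, ← hP.fderiv_phat_apply le_rfl,
    ← hP.fderiv_qhat_apply le_rfl]
  have hq := hP.c_pos.trans_le (hP.le_qhat le_rfl (hP.nbr_nonempty i) w)
  have hd := ((hP.phat_smooth le_rfl (hP.nbr_nonempty i)).diff w).hasFDerivAt.mul
    ((hasDerivAt_inv hq.ne').comp_hasFDerivAt w
      ((hP.qhat_smooth le_rfl (hP.nbr_nonempty i)).diff w).hasFDerivAt)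
  have he : fderiv ℝ (fun w => P.phat i (P.nbr i) w * (P.qhat i (P.nbr i) w)⁻¹) w = _ :=
    HasFDerivAt.fderiv hd
  rw [he]
  simp only [_root_.add_apply, _root_.smul_apply, smul_eq_mul,
    Function.comp]
  ring

lemma norm_gest_le (hP : P.Good K D L c) {β : Batch n} (hβ : P.Valid β) (w : P.Param)
    {a b : Fin n → ℝ} (ha : ∀ i, |a i| ≤ K) (hb : ∀ i ∈ β.anchors, c ≤ b i) :
    ‖P.gest β w a b‖ ≤ c⁻¹ * D + K / c ^ 2 * D := by
  have hc := hP.c_pos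
  rw [gest, norm_smul, Real.norm_of_nonneg (by positivity)]
  refine le_trans (mul_le_mul_of_nonneg_left (norm_sum_le _ _) (by positivity))
    (mean_le hβ.anchors_nonempty fun i hi => ?_)
  have hg : ∀ f : P.Param → ℝ, BddSmooth f K D L → ‖gradient f w‖ ≤ D := fun f hf => by
    rw [gradient, LinearIsometryEquiv.norm_map]
    exact hf.fderiv_bdd w
  have hbc := hb i hi
  have hb0 : 0 < b i := hc.trans_le hbc
  have hK : 0 ≤ K := (abs_nonneg _).trans (ha i)
  refine (norm_add_le _ _).trans (add_le_add ?_ ?_)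
  · rw [norm_smul, one_div, norm_inv, Real.norm_of_nonneg hb0.le]
    exact mul_le_mul (inv_anti₀ hc hbc) (hg _ (hP.phat_smooth (hβ.subset i hi) (hβ.nonempty i hi)))
      (norm_nonneg _) (by positivity)
  · rw [norm_smul, norm_div, norm_neg, Real.norm_eq_abs, Real.norm_of_nonneg (by positivity)]
    refine mul_le_mul ?_ (hg _ (hP.qhat_smooth (hβ.subset i hi) (hβ.nonempty i hi)))
      (norm_nonneg _) (by positivity)
    gcongr
    exact ha i

end Good
end Problem

/-! ### Scalar inequalities for quotients and moving averages. -/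

/-- The weights `1/b` and `a/b²` are Lipschitz in `(a, b)` near `(p, q)` because both denominators
stay above `c`. After this replacement the main term is linear in the stochastic gradients `x` and
`y`, with weights independent of the batch. No bound on `a` is needed, since only the difference `a
- p` enters. -/
lemma quotient_gradient_ge {a b p q x y c K Y : ℝ} (hc : 0 < c) (hb : c ≤ b) (hq : c ≤ q)
    (hp : |p| ≤ K) (hx : |x| ≤ Y) (hy : |y| ≤ Y) :
    1 / q * x - p / q ^ 2 * y - (2 / c ^ 2 + 2 * K / c ^ 3) * Y * (|a - p| + |b - q|)
      ≤ 1 / b * x - a / b ^ 2 * y := by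
  have hb0 : 0 < b := hc.trans_le hb
  have hq0 : 0 < q := hc.trans_le hq
  have hK : 0 ≤ K := (abs_nonneg _).trans hp
  have hY : 0 ≤ Y := (abs_nonneg _).trans hx
  have e : 1 / b * x - a / b ^ 2 * y = 1 / q * x - p / q ^ 2 * y
      - ((b * q)⁻¹ * (b - q) * x + (b ^ 2)⁻¹ * (a - p) * y
        - p * (((b * q ^ 2)⁻¹ + (b ^ 2 * q)⁻¹) * (b - q)) * y) := by
    field_simp; ring
  have h1 : |(b * q)⁻¹ * (b - q) * x| ≤ (c * c)⁻¹ * |b - q| * Y := by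
    rw [abs_mul, abs_mul, abs_of_pos (by positivity : 0 < (b * q)⁻¹)]
    gcongr
  have h2 : |(b ^ 2)⁻¹ * (a - p) * y| ≤ (c ^ 2)⁻¹ * |a - p| * Y := by
    rw [abs_mul, abs_mul, abs_of_pos (by positivity : 0 < (b ^ 2)⁻¹)]
    gcongr
  have h3 : |p * (((b * q ^ 2)⁻¹ + (b ^ 2 * q)⁻¹) * (b - q)) * y|
      ≤ K * (((c * c ^ 2)⁻¹ + (c ^ 2 * c)⁻¹) * |b - q|) * Y := by
    rw [abs_mul, abs_mul, abs_mul,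
      abs_of_pos (by positivity : 0 < (b * q ^ 2)⁻¹ + (b ^ 2 * q)⁻¹)]
    gcongr
  have e1 : (2 / c ^ 2 + 2 * K / c ^ 3) * Y * (|a - p| + |b - q|)
      = (c * c)⁻¹ * |b - q| * Y + (c ^ 2)⁻¹ * |a - p| * Y
        + K * (((c * c ^ 2)⁻¹ + (c ^ 2 * c)⁻¹) * |b - q|) * Y
        + ((c * c)⁻¹ * |b - q| * Y + (c ^ 2)⁻¹ * |a - p| * Y + 2 * K / c ^ 3 * Y * |a - p|) := by
    field_simp; ring
  have h4 : 0 ≤ (c * c)⁻¹ * |b - q| * Y + (c ^ 2)⁻¹ * |a - p| * Y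
      + 2 * K / c ^ 3 * Y * |a - p| := by positivity
  rw [e, e1]
  linarith [le_abs_self ((b * q)⁻¹ * (b - q) * x), le_abs_self ((b ^ 2)⁻¹ * (a - p) * y),
    neg_abs_le (p * (((b * q ^ 2)⁻¹ + (b ^ 2 * q)⁻¹) * (b - q)) * y)]

/-- Truncation is the projection onto `[v, ∞)`, which contains the target `q`; it therefore never
increases the tracking error, whatever the level `v`. -/
lemma abs_max_sub_le {x v q : ℝ} (h : v ≤ q) : |max x v - q| ≤ |x - q| := by
  rcases le_total x v with hx | hx
  · rw [max_eq_right hx, abs_sub_comm, abs_sub_comm x, abs_of_nonneg (sub_nonneg.2 h),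
      abs_of_nonneg (sub_nonneg.2 (hx.trans h))]
    linarith
  · rw [max_eq_left hx]

lemma abs_moving_average_sub_le {γ a p z K : ℝ} (h₀ : 0 ≤ γ) (h₁ : γ ≤ 1) (hp : |p| ≤ K)
    (hz : |z| ≤ K) : |(1 - γ) * a + γ * z - p| ≤ |a - p| + 2 * K * γ := by
  have e : (1 - γ) * a + γ * z - p = (1 - γ) * (a - p) + γ * (z - p) := by ring
  rw [e]
  refine (abs_add_le _ _).trans ?_
  rw [abs_mul, abs_mul, abs_of_nonneg h₀, abs_of_nonneg (sub_nonneg.2 h₁)]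
  have : |z - p| ≤ 2 * K := (abs_sub _ _).trans (by linarith)
  nlinarith [abs_nonneg (a - p)]

/-- The square is expanded and the cross term kept exact: it is linear in the sample `z`, so it
averages to zero when `z` has mean `p`. -/
lemma moving_average_sub_sq_le {γ a p z K : ℝ} (h₀ : 0 ≤ γ) (h₁ : γ ≤ 1) (hp : |p| ≤ K)
    (hz : |z| ≤ K) : ((1 - γ) * a + γ * z - p) ^ 2
      ≤ (1 - γ) * (a - p) ^ 2 + 4 * K ^ 2 * γ ^ 2 + 2 * γ * (1 - γ) * ((a - p) * (z - p)) := by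
  have e : ((1 - γ) * a + γ * z - p) ^ 2 = (1 - γ) ^ 2 * (a - p) ^ 2 + γ ^ 2 * (z - p) ^ 2
      + 2 * γ * (1 - γ) * ((a - p) * (z - p)) := by ring
  rw [e]
  have h2 : |z - p| ≤ 2 * K := (abs_sub _ _).trans (by linarith)
  have h3 : (z - p) ^ 2 ≤ (2 * K) ^ 2 := sq_le_sq' (by linarith [abs_le.1 h2]) (abs_le.1 h2).2
  have h4 : (1 - γ) ^ 2 ≤ 1 - γ := by nlinarith
  nlinarith [mul_le_mul_of_nonneg_right h4 (sq_nonneg (a - p)),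
    mul_le_mul_of_nonneg_left h3 (sq_nonneg γ)]

/-! ### Pathwise bounds for one iteration: estimated descent and tracking error. -/

namespace Problem

variable {𝒳 : Type*} {df dc m C A n : ℕ} {P : Problem 𝒳 df dc m C A n} {K D L c : ℝ}

/-- Moving-average update of the normalized numerators. -/
def upA (P : Problem 𝒳 df dc m C A n) (γ : ℝ) (β : Batch n) (w : P.Param) (a : Fin n → ℝ)
    (i : Fin n) : ℝ :=
  if i ∈ β.anchors then (1 - γ) * a i + γ * P.phat i (β.nbrs i) w else a i

/-- Truncated moving-average update of the normalized denominators. -/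
def upB (P : Problem 𝒳 df dc m C A n) (γ v₀ : ℝ) (β : Batch n) (w : P.Param) (b : Fin n → ℝ)
    (i : Fin n) : ℝ :=
  if i ∈ β.anchors then max ((1 - γ) * b i + γ * P.qhat i (β.nbrs i) w) v₀ else b i

/-- The contribution of the pair `(i, j)` to the lower bound for the estimated descent. -/
def descentPart (P : Problem 𝒳 df dc m C A n) (lo X : ℝ) (w v : P.Param) (a b : Fin n → ℝ)
    (E : ℝ) (i j : Fin n) : ℝ :=
  1 / P.qhat i (P.nbr i) w * fderiv ℝ (P.pw i j) w v
    - P.phat i (P.nbr i) w / (P.qhat i (P.nbr i) w) ^ 2 * fderiv ℝ (P.qw i j) w v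
    - (lo / 2 * ‖gradient P.R w‖ ^ 2 + X * (P.err w a b i + E))

/-- The contribution of the pair `(i, j)` to the change of the squared error. -/
def errPart (P : Problem 𝒳 df dc m C A n) (γ K : ℝ) (w : P.Param) (a b : Fin n → ℝ)
    (i j : Fin n) : ℝ :=
  8 * K ^ 2 * γ ^ 2 - γ * P.err w a b i
    + 2 * γ * (1 - γ) * ((a i - P.phat i (P.nbr i) w) * (P.pw i j w - P.phat i (P.nbr i) w)
      + (b i - P.qhat i (P.nbr i) w) * (P.qw i j w - P.qhat i (P.nbr i) w))

/-- Over the full neighbourhood the cross terms cancel, because `phat` and `qhat` are the means of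
`pw` and `qw`. -/
lemma mean_mean_errPart (hne : ∀ i, (P.nbr i).Nonempty) (γ K : ℝ) (w : P.Param)
    (a b : Fin n → ℝ) (i : Fin n) :
    mean (P.nbr i) (P.errPart γ K w a b i) = 8 * K ^ 2 * γ ^ 2 - γ * P.err w a b i := by
  have h := hne i
  unfold errPart
  rw [mean_add, mean_const h, mean_const_mul, mean_add, mean_const_mul, mean_const_mul, mean_sub,
    mean_sub, mean_const h, mean_const h]
  change _ + 2 * γ * (1 - γ) * (_ * (P.phat i (P.nbr i) w - _) + _ * (P.qhat i (P.nbr i) w - _)) = _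
  ring

/-- The coefficient of the squared error in the descent estimate. -/
def descentCoef (K D c lo hi : ℝ) : ℝ :=
  3 * ((2 / c ^ 2 + 2 * K / c ^ 3) * (D * hi)) ^ 2 / (2 * lo)

namespace Good

lemma mean_mean_descentPart (hP : P.Good K D L c) (hn : 0 < n) (lo X : ℝ) (w v : P.Param)
    (a b : Fin n → ℝ) (E : ℝ) :
    mean Finset.univ (fun i => mean (P.nbr i) (P.descentPart lo X w v a b E i))
      = fderiv ℝ P.R w v - (lo / 2 * ‖gradient P.R w‖ ^ 2 + X * (P.merr w a b + E)) := by
  have : Nonempty (Fin n) := ⟨⟨0, hn⟩⟩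
  have e : ∀ i, mean (P.nbr i) (P.descentPart lo X w v a b E i) = _ := fun i => by
    unfold descentPart
    rw [mean_sub, mean_const (hP.nbr_nonempty i)]
  simp_rw [e]
  rw [mean_sub, ← hP.fderiv_R_apply hn, mean_add, mean_const Finset.univ_nonempty, mean_const_mul,
    mean_add, mean_const Finset.univ_nonempty]
  rfl

lemma abs_phat_le (hP : P.Good K D L c) {i : Fin n} {S : Finset (Fin n)} (hS : S ⊆ P.nbr i)
    (hne : S.Nonempty) (w : P.Param) : |P.phat i S w| ≤ K := (hP.phat_smooth hS hne).bdd w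

lemma abs_qhat_le (hP : P.Good K D L c) {i : Fin n} {S : Finset (Fin n)} (hS : S ⊆ P.nbr i)
    (hne : S.Nonempty) (w : P.Param) : |P.qhat i S w| ≤ K := (hP.qhat_smooth hS hne).bdd w

lemma le_upB (hP : P.Good K D L c) {β : Batch n} (hβ : P.Valid β) {γ : ℝ} (h₀ : 0 ≤ γ)
    (h₁ : γ ≤ 1) {b : Fin n → ℝ} (hb : ∀ i, c ≤ b i) (v₀ : ℝ) (w : P.Param) (i : Fin n) :
    c ≤ P.upB γ v₀ β w b i := by
  unfold upB
  split_ifs with hi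
  · refine le_max_of_le_left ?_
    have := hP.le_qhat (hβ.subset i hi) (hβ.nonempty i hi) w
    nlinarith [hb i]
  · exact hb i

lemma abs_upA_le (hP : P.Good K D L c) {β : Batch n} (hβ : P.Valid β) {γ : ℝ} (h₀ : 0 ≤ γ)
    (h₁ : γ ≤ 1) {a : Fin n → ℝ} (ha : ∀ i, |a i| ≤ K) (w : P.Param)
    (i : Fin n) : |P.upA γ β w a i| ≤ K := by
  unfold upA
  split_ifs with hi
  · have h := abs_le.1 (hP.abs_phat_le (hβ.subset i hi) (hβ.nonempty i hi) w)
    have h2 := abs_le.1 (ha i)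
    refine abs_le.2 ⟨?_, ?_⟩ <;> nlinarith
  · exact ha i

/-- The updated moving averages depend on the batch, so expectations cannot be taken directly in the
right-hand side. The left-hand side uses the batch only as an average of a function of pairs, at the
price of the tracking error before the update and of the term in `γ²`. -/
lemma descentPart_le (hP : P.Good K D L c) {β : Batch n} (hβ : P.Valid β)
    {γ v₀ lo hi : ℝ} (h₀ : 0 ≤ γ) (h₁ : γ ≤ 1) {a b : Fin n → ℝ} (hb : ∀ i, c ≤ b i)
    (w : P.Param) (hv₀ : ∀ i, v₀ ≤ P.qhat i (P.nbr i) w) (hlo : 0 < lo)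
    {d : P.variant.Idx → ℝ} (hd : ∀ l, lo ≤ d l) (hd' : ∀ l, d l ≤ hi) (hhi : 0 ≤ hi) :
    mean β.anchors (fun i => mean (β.nbrs i) (P.descentPart lo (descentCoef K D c lo hi) w
        (diag d (gradient P.R w)) a b (16 * K ^ 2 * γ ^ 2) i))
      ≤ inner ℝ (gradient P.R w) (diag d (P.gest β w (P.upA γ β w a) (P.upB γ v₀ β w b))) := by
  rw [← inner_diag_left, inner_gest]
  set v := diag d (gradient P.R w) with hv
  refine mean_le_mean fun i hi' => ?_
  have hs := hβ.subset i hi'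
  have hne := hβ.nonempty i hi'
  have hnb := hP.nbr_nonempty i
  unfold descentPart
  rw [mean_sub, mean_const hne, mean_sub, mean_const_mul, mean_const_mul,
    ← hP.fderiv_phat_apply hs, ← hP.fderiv_qhat_apply hs]
  have hvn : ‖v‖ ≤ hi * ‖gradient P.R w‖ :=
    norm_diag_le _ (fun l => hlo.le.trans (hd l)) hd' hhi
  have hD : 0 ≤ D := (hP.phat_smooth hs hne).nonneg_fderiv_bdd
  have hK : 0 ≤ K := (hP.phat_smooth hs hne).nonneg_bdd
  have hYle : D * ‖v‖ ≤ D * hi * ‖gradient P.R w‖ := by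
    rw [mul_assoc]; gcongr
  refine le_trans ?_ (quotient_gradient_ge (p := P.phat i (P.nbr i) w)
    (q := P.qhat i (P.nbr i) w) hP.c_pos (hP.le_upB hβ h₀ h₁ hb v₀ w i)
    (hP.le_qhat le_rfl hnb w) (hP.abs_phat_le le_rfl hnb w)
    (((hP.phat_smooth hs hne).abs_fderiv_apply_le w v).trans hYle)
    (((hP.qhat_smooth hs hne).abs_fderiv_apply_le w v).trans hYle))
  gcongr
  have hA : |P.upA γ β w a i - P.phat i (P.nbr i) w|
      ≤ |a i - P.phat i (P.nbr i) w| + 2 * K * γ := by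
    rw [upA, if_pos hi']
    exact abs_moving_average_sub_le h₀ h₁ (hP.abs_phat_le le_rfl hnb w) (hP.abs_phat_le hs hne w)
  have hB : |P.upB γ v₀ β w b i - P.qhat i (P.nbr i) w|
      ≤ |b i - P.qhat i (P.nbr i) w| + 2 * K * γ := by
    rw [upB, if_pos hi']
    exact (abs_max_sub_le (hv₀ i)).trans (abs_moving_average_sub_le h₀ h₁
      (hP.abs_qhat_le le_rfl hnb w) (hP.abs_qhat_le hs hne w))
  have hc := hP.c_pos
  set X := (2 / c ^ 2 + 2 * K / c ^ 3) * (D * hi) with hX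
  have hX0 : 0 ≤ X := by positivity
  set r := ‖gradient P.R w‖ with hr
  set s := |a i - P.phat i (P.nbr i) w|
  set t := |b i - P.qhat i (P.nbr i) w|
  have hs2 : P.err w a b i = s ^ 2 + t ^ 2 := by
    simp only [err, s, t, sq_abs]
  -- Each coordinate moves by at most `2 K γ` in the update, whence `4 K γ`; the factor `3` is
  -- Cauchy–Schwarz for three terms.
  have hy : (s + t + 4 * K * γ) ^ 2 ≤ 3 * (s ^ 2 + t ^ 2 + 16 * K ^ 2 * γ ^ 2) := by
    nlinarith [sq_nonneg (s - t), sq_nonneg (s - 4 * K * γ), sq_nonneg (t - 4 * K * γ)]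
  calc (2 / c ^ 2 + 2 * K / c ^ 3) * (D * hi * r) * _
      = X * r * (|P.upA γ β w a i - P.phat i (P.nbr i) w|
          + |P.upB γ v₀ β w b i - P.qhat i (P.nbr i) w|) := by rw [hX]; ring
    _ ≤ X * r * (s + t + 4 * K * γ) :=
        mul_le_mul_of_nonneg_left (by linarith) (by positivity)
    -- Young's inequality with weight `lo / 2`: it spends half of the descent `lo ‖∇R‖²` and keeps
    -- the other half.
    _ ≤ lo / 2 * r ^ 2 + X ^ 2 / (2 * lo) * (s + t + 4 * K * γ) ^ 2 := by
        have : lo / 2 * r ^ 2 + X ^ 2 / (2 * lo) * (s + t + 4 * K * γ) ^ 2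
            - X * r * (s + t + 4 * K * γ)
            = (lo * r - X * (s + t + 4 * K * γ)) ^ 2 / (2 * lo) := by
          field_simp; ring
        have h5 : 0 ≤ (lo * r - X * (s + t + 4 * K * γ)) ^ 2 / (2 * lo) := by positivity
        linarith
    _ ≤ lo / 2 * r ^ 2 + X ^ 2 / (2 * lo) * (3 * (s ^ 2 + t ^ 2 + 16 * K ^ 2 * γ ^ 2)) := by
        gcongr
    _ = _ := by
        rw [descentCoef, ← hX, hs2]
        ring

/-- Only sampled indices change, so the increment is a sum over the anchors of averages of a
function of pairs. The parameter is frozen at `w` here; its motion is accounted for in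
`merr_drift_le`. -/
lemma merr_update_le (hP : P.Good K D L c) {β : Batch n} (hβ : P.Valid β)
    {γ v₀ : ℝ} (h₀ : 0 ≤ γ) (h₁ : γ ≤ 1) (a b : Fin n → ℝ)
    (w : P.Param) (hv₀ : ∀ i, v₀ ≤ P.qhat i (P.nbr i) w) :
    P.merr w (P.upA γ β w a) (P.upB γ v₀ β w b) ≤ P.merr w a b
      + (n : ℝ)⁻¹ * ∑ i ∈ β.anchors, mean (β.nbrs i) (P.errPart γ K w a b i) := by
  have key : ∀ i, P.err w (P.upA γ β w a) (P.upB γ v₀ β w b) i ≤ P.err w a b i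
      + if i ∈ β.anchors then mean (β.nbrs i) (P.errPart γ K w a b i) else 0 := fun i => by
    by_cases hi : i ∈ β.anchors
    · have hs := hβ.subset i hi
      have hne := hβ.nonempty i hi
      have hnb := hP.nbr_nonempty i
      rw [if_pos hi]
      unfold errPart
      rw [mean_add, mean_const hne, mean_const_mul, mean_add, mean_const_mul, mean_const_mul,
        mean_sub, mean_sub, mean_const hne, mean_const hne]
      have hA := moving_average_sub_sq_le (a := a i) h₀ h₁ (hP.abs_phat_le le_rfl hnb w)
        (hP.abs_phat_le hs hne w)
      have hB := moving_average_sub_sq_le (a := b i) h₀ h₁ (hP.abs_qhat_le le_rfl hnb w)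
        (hP.abs_qhat_le hs hne w)
      have hB' := sq_le_sq.2 (abs_max_sub_le (x := (1 - γ) * b i + γ * P.qhat i (β.nbrs i) w)
        (hv₀ i))
      have e : P.err w (P.upA γ β w a) (P.upB γ v₀ β w b) i
          = ((1 - γ) * a i + γ * P.phat i (β.nbrs i) w - P.phat i (P.nbr i) w) ^ 2
            + (max ((1 - γ) * b i + γ * P.qhat i (β.nbrs i) w) v₀
              - P.qhat i (P.nbr i) w) ^ 2 := by
        rw [err, upA, upB, if_pos hi, if_pos hi]
      rw [e]
      change _ ≤ _ + (_ + 2 * γ * (1 - γ) * (_ * (P.phat i (β.nbrs i) w - _)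
        + _ * (P.qhat i (β.nbrs i) w - _)))
      simp only [err]
      linarith
    · rw [if_neg hi, err, upA, upB, if_neg hi, if_neg hi, add_zero, err]
  refine (mean_le_mean fun i _ => key i).trans ?_
  rw [mean_add, merr]
  gcongr
  simp [mean, Finset.sum_ite_mem]

/-- The targets are `D`-Lipschitz in the parameter, and Young's inequality with weight `δ` trades a
slight loss of contraction against the squared displacement. -/
lemma merr_drift_le (hP : P.Good K D L c) {δ : ℝ} (hδ : 0 < δ) (a b : Fin n → ℝ)
    (w w' : P.Param) (hn : 0 < n) :
    P.merr w' a b ≤ (1 + δ) * P.merr w a b + (1 + δ⁻¹) * (2 * D ^ 2 * ‖w' - w‖ ^ 2) := by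
  have : Nonempty (Fin n) := ⟨⟨0, hn⟩⟩
  have young : ∀ x y : ℝ, (x - y) ^ 2 ≤ (1 + δ) * x ^ 2 + (1 + δ⁻¹) * y ^ 2 := fun x y => by
    have : (1 + δ) * x ^ 2 + (1 + δ⁻¹) * y ^ 2 - (x - y) ^ 2 = δ * (x + δ⁻¹ * y) ^ 2 := by
      field_simp; ring
    nlinarith [mul_nonneg hδ.le (sq_nonneg (x + δ⁻¹ * y))]
  have sq_lip : ∀ f : P.Param → ℝ, BddSmooth f K D L →
      (f w' - f w) ^ 2 ≤ D ^ 2 * ‖w' - w‖ ^ 2 := fun f hf => by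
    rw [← mul_pow, ← sq_abs]
    exact pow_le_pow_left₀ (abs_nonneg _) (hf.lip w' w) 2
  unfold merr
  rw [← mean_const_mul, ← mean_const (S := (Finset.univ : Finset (Fin n))) Finset.univ_nonempty
    ((1 + δ⁻¹) * (2 * D ^ 2 * ‖w' - w‖ ^ 2)), ← mean_add]
  refine mean_le_mean fun i _ => ?_
  have hnb := hP.nbr_nonempty i
  have h1 := sq_lip _ (hP.phat_smooth le_rfl hnb)
  have h2 := sq_lip _ (hP.qhat_smooth le_rfl hnb)
  have y1 := young (a i - P.phat i (P.nbr i) w) (P.phat i (P.nbr i) w' - P.phat i (P.nbr i) w)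
  have y2 := young (b i - P.qhat i (P.nbr i) w) (P.qhat i (P.nbr i) w' - P.qhat i (P.nbr i) w)
  have hδ' : 0 < 1 + δ⁻¹ := by positivity
  have h3 := mul_le_mul_of_nonneg_left h1 hδ'.le
  have h4 := mul_le_mul_of_nonneg_left h2 hδ'.le
  rw [sub_sub_sub_cancel_right] at y1 y2
  simp only [err]
  linarith

lemma err_le (hP : P.Good K D L c) {a b : Fin n → ℝ} (ha : ∀ i, |a i| ≤ K) (hb : ∀ i, |b i| ≤ K)
    (w : P.Param) (i : Fin n) : P.err w a b i ≤ 8 * K ^ 2 := by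
  have hnb := hP.nbr_nonempty i
  have h : ∀ x y : ℝ, |x| ≤ K → |y| ≤ K → (x - y) ^ 2 ≤ 4 * K ^ 2 := fun x y hx hy => by
    have := abs_le.1 hx
    have := abs_le.1 hy
    nlinarith
  have h1 := h _ _ (ha i) (hP.abs_phat_le le_rfl hnb w)
  have h2 := h _ _ (hb i) (hP.abs_qhat_le le_rfl hnb w)
  simp only [err]
  linarith

end Good
end Problem

/-! ### Descent and momentum inequalities for a smooth objective. -/

section

variable {ι : Type*} [Fintype ι] {f : EuclideanSpace ℝ ι → ℝ} {K D L : ℝ}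

lemma BddSmooth.norm_gradient_le (hf : BddSmooth f K D L) (w : EuclideanSpace ℝ ι) :
    ‖gradient f w‖ ≤ D := by
  rw [gradient, LinearIsometryEquiv.norm_map]
  exact hf.fderiv_bdd w

lemma BddSmooth.norm_gradient_sub_le (hf : BddSmooth f K D L) (w w' : EuclideanSpace ℝ ι) :
    ‖gradient f w - gradient f w'‖ ≤ L * ‖w - w'‖ := by
  rw [gradient, gradient, ← map_sub, LinearIsometryEquiv.norm_map]
  exact hf.fderiv_lip w w'

/-- Decrease of the objective along a preconditioned momentum step. -/
lemma BddSmooth.step_le (hf : BddSmooth f K D L) (hL : 0 ≤ L) {w w' z : EuclideanSpace ℝ ι}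
    {α ρ : ℝ} (hα : 0 ≤ α) (hw : w' = w - α • z) (hz : ‖z‖ ≤ ρ) :
    f w' ≤ f w - α * inner ℝ (gradient f w') z + 2 * L * ρ ^ 2 * α ^ 2 := by
  have hd := hf.descent hL w w'
  have e : w' - w = -(α • z) := by rw [hw]; abel
  have hn : ‖w' - w‖ ≤ α * ρ := by
    rw [e, norm_neg, norm_smul, Real.norm_of_nonneg hα]
    gcongr
  have e2 : fderiv ℝ f w (w' - w) = -(α * inner ℝ (gradient f w) z) := by
    rw [inner_gradient_left, e, map_neg, map_smul, smul_eq_mul]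
  -- The gradient is moved to the new point, where the correlation with the new momentum is
  -- evaluated. This costs a second `L ρ² α²`, hence the factor `2`.
  have h3 : inner ℝ (gradient f w') z - inner ℝ (gradient f w) z ≤ L * (α * ρ) * ρ := by
    rw [← inner_sub_left]
    refine (real_inner_le_norm _ _).trans (mul_le_mul ?_ hz (norm_nonneg _) ?_)
    · exact (hf.norm_gradient_sub_le w' w).trans (by gcongr)
    · have := (norm_nonneg _).trans hz
      positivity
  have h4 : ‖w' - w‖ ^ 2 ≤ (α * ρ) ^ 2 := pow_le_pow_left₀ (norm_nonneg _) hn 2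
  rw [e2] at hd
  nlinarith [mul_le_mul_of_nonneg_left h3 hα, mul_le_mul_of_nonneg_left h4 hL]

/-- Recursion for the correlation of the gradient with the preconditioned momentum. -/
lemma BddSmooth.momentum_ge (hf : BddSmooth f K D L) (hL : 0 ≤ L)
    {w w' h h' G : EuclideanSpace ℝ ι} {d d' : ι → ℝ} {α ρ η Γ : ℝ} (hα : 0 ≤ α)
    (hw : w' = w - α • diag d' h') (hh : h' = η • h + (1 - η) • G) (hz : ‖diag d' h'‖ ≤ ρ)
    (hΓ : ‖h'‖ ≤ Γ) (hd : ∀ l, d' l ≤ d l) :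
    η * inner ℝ (gradient f w) (diag d h) + (1 - η) * inner ℝ (gradient f w) (diag d G)
        - L * ρ ^ 2 * α - D * Γ * (∑ l, d l - ∑ l, d' l)
      ≤ inner ℝ (gradient f w') (diag d' h') := by
  have hD := hf.nonneg_fderiv_bdd
  have hρ := (norm_nonneg _).trans hz
  have hn : ‖w - w'‖ ≤ α * ρ := by
    rw [hw, sub_sub_cancel, norm_smul, Real.norm_of_nonneg hα]
    gcongr
  have h3 : inner ℝ (gradient f w) (diag d' h') - inner ℝ (gradient f w') (diag d' h')
      ≤ L * (α * ρ) * ρ := by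
    rw [← inner_sub_left]
    refine (real_inner_le_norm _ _).trans (mul_le_mul ?_ hz (norm_nonneg _) (by positivity))
    exact (hf.norm_gradient_sub_le w w').trans (by gcongr)
  -- The new estimator is paired with the old gradient and the old preconditioner, both fixed before
  -- the batch is drawn; replacing `d'` by `d` costs only the lost trace.
  have h4 := inner_diag_sub_le (gradient f w) h' hd
  have h5 : inner ℝ (gradient f w) (diag d h') = η * inner ℝ (gradient f w) (diag d h)
      + (1 - η) * inner ℝ (gradient f w) (diag d G) := by
    have : diag d h' = η • diag d h + (1 - η) • diag d G := by
      rw [hh]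
      ext l
      simp only [diag, PiLp.add_apply, PiLp.smul_apply, smul_eq_mul]
      ring
    rw [this, inner_add_right, real_inner_smul_right, real_inner_smul_right]
  have h6 : ‖gradient f w‖ * ‖h'‖ * (∑ l, d l - ∑ l, d' l)
      ≤ D * Γ * (∑ l, d l - ∑ l, d' l) := by
    have : 0 ≤ ∑ l, d l - ∑ l, d' l := sub_nonneg.2 (Finset.sum_le_sum fun l _ => hd l)
    gcongr
    exact hf.norm_gradient_le w
  nlinarith

end

/-! ### Functionals of finitely many batches and integration over a fresh batch. -/

/-- With finite `X`, the factor lives on a finite discrete space, so measurability and integrability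
of the whole process become automatic. -/
lemma DependsOn.exists_factor {X α : Type*} [Nonempty X] {F : (ℕ → X) → α} {k : ℕ}
    (hF : DependsOn F (Set.Iio k)) :
    ∃ F' : (Finset.range k → X) → α, ∀ b, F b = F' fun i => b i := by
  classical
  let x₀ : X := Classical.arbitrary X
  refine ⟨fun r => F fun j => if h : j ∈ Finset.range k then r ⟨j, h⟩ else x₀, fun b => ?_⟩
  refine hF fun j hj => ?_
  rw [dif_pos (Finset.mem_range.2 hj)]

section FiniteProcess

variable {Ω X : Type*} [MeasurableSpace Ω] {μ : Measure Ω} [Finite X] [Nonempty X]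
  [MeasurableSpace X] [DiscreteMeasurableSpace X] {β : ℕ → Ω → X}

lemma integrable_comp_of_finite [IsFiniteMeasure μ] {Y : Type*} [Finite Y] [MeasurableSpace Y]
    [DiscreteMeasurableSpace Y] {Z : Ω → Y} (hZ : Measurable Z) (F : Y → ℝ) :
    Integrable (fun ω => F (Z ω)) μ :=
  (integrable_map_measure (Measurable.of_discrete).aestronglyMeasurable hZ.aemeasurable).1
    (Integrable.of_finite)

lemma integrable_of_dependsOn [IsFiniteMeasure μ] (hβ : ∀ k, Measurable (β k)) {k : ℕ}
    {F : (ℕ → X) → ℝ} (hF : DependsOn F (Set.Iio k)) :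
    Integrable (fun ω => F fun j => β j ω) μ := by
  obtain ⟨F', hF'⟩ := hF.exists_factor
  simp_rw [hF']
  exact integrable_comp_of_finite (Z := fun ω (i : Finset.range k) => β i ω)
    (measurable_pi_lambda _ fun i => hβ i) F'

/-- A functional of the past and of the current, independent, sample may be integrated over the
current sample first. -/
lemma integral_eq_integral_integral_fresh [IsProbabilityMeasure μ] (hβ : ∀ k, Measurable (β k))
    (hind : iIndepFun β μ) {k : ℕ} {F : (ℕ → X) → X → ℝ} (hF : DependsOn F (Set.Iio k)) :
    ∫ ω, F (fun j => β j ω) (β k ω) ∂μ = ∫ ω, ∫ ω', F (fun j => β j ω) (β k ω') ∂μ ∂μ := by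
  obtain ⟨F', hF'⟩ := hF.exists_factor
  simp_rw [hF']
  set Z : Ω → (Finset.range k → X) := fun ω i => β i ω with hZdef
  have hZ : Measurable Z := measurable_pi_lambda _ fun i => hβ i
  have hi : IndepFun Z (β k) μ := by
    have h := hind.indepFun_finset (Finset.range k) {k} (by simp) hβ
    exact h.comp (ψ := fun r : ({k} : Finset ℕ) → X => r ⟨k, Finset.mem_singleton_self k⟩)
      measurable_id Measurable.of_discrete
  -- The joint law of the past and the current batch is a product, so Fubini takes the place of
  -- conditional expectation.
  have hmap := (indepFun_iff_map_prod_eq_prod_map_map hZ.aemeasurable (hβ k).aemeasurable).1 hi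
  have : IsProbabilityMeasure (μ.map Z) := Measure.isProbabilityMeasure_map hZ.aemeasurable
  have : IsProbabilityMeasure (μ.map (β k)) :=
    Measure.isProbabilityMeasure_map (hβ k).aemeasurable
  calc ∫ ω, F' (Z ω) (β k ω) ∂μ
      = ∫ z, F' z.1 z.2 ∂(μ.map fun ω => (Z ω, β k ω)) :=
        (integral_map (f := fun z : (Finset.range k → X) × X => F' z.1 z.2)
          (hZ.prodMk (hβ k)).aemeasurable
          (Measurable.of_discrete).aestronglyMeasurable).symm
    _ = ∫ z, ∫ x, F' z x ∂(μ.map (β k)) ∂(μ.map Z) := by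
        rw [hmap, integral_prod _ (Integrable.of_finite)]
    _ = ∫ ω, ∫ x, F' (Z ω) x ∂(μ.map (β k)) ∂μ :=
        integral_map hZ.aemeasurable (Measurable.of_discrete).aestronglyMeasurable
    _ = _ := by
        congr 1
        funext ω
        exact integral_map (hβ k).aemeasurable (Measurable.of_discrete).aestronglyMeasurable

end FiniteProcess

instance instFiniteBatch (n : ℕ) : Finite (Batch n) :=
  Finite.of_injective (fun b : Batch n => (b.anchors, b.nbrs)) fun b b' h => by
    cases b
    cases b'
    simpa using h

instance instNonemptyBatch (n : ℕ) : Nonempty (Batch n) := ⟨⟨∅, fun _ => ∅⟩⟩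

instance instDiscreteMeasurableSpaceBatch (n : ℕ) : DiscreteMeasurableSpace (Batch n) :=
  ⟨fun _ => trivial⟩

/-! ### Unbiasedness of the sampling scheme. -/

namespace Problem.IsUniformBatch

variable {𝒳 : Type*} {df dc m C A n : ℕ} {P : Problem 𝒳 df dc m C A n} {Ω : Type*}
  [MeasurableSpace Ω] {μ : Measure Ω} {B : ℕ} {β : Ω → Batch n}

lemma valid (h : P.IsUniformBatch μ B β) (hB : 0 < B) (ω : Ω) : P.Valid (β ω) :=
  ⟨Finset.card_pos.1 ((h.card ω).symm ▸ hB), fun i hi => (h.nbrs_valid ω i hi).1,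
    fun i hi => (h.nbrs_valid ω i hi).2⟩

lemma le_card [IsProbabilityMeasure μ] (h : P.IsUniformBatch μ B β) : B ≤ n := by
  obtain ⟨ω⟩ : Nonempty Ω := nonempty_of_isProbabilityMeasure μ
  rw [← h.card ω]
  simpa using Finset.card_le_univ (β ω).anchors

/-- By linearity only the expected weight of each pair `(i, j)` matters, and that is what
`nbrs_prob` prescribes. No independence between indices within a batch, or between anchors and
neighbourhoods, enters. -/
lemma integral_sum_mean [IsProbabilityMeasure μ] (h : P.IsUniformBatch μ B β)
    (F : Fin n → Fin n → ℝ) :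
    ∫ ω, ∑ i ∈ (β ω).anchors, mean ((β ω).nbrs i) (F i) ∂μ
      = (B : ℝ) / n * ∑ i, mean (P.nbr i) (F i) := by
  have e : ∀ ω, ∑ i ∈ (β ω).anchors, mean ((β ω).nbrs i) (F i)
      = ∑ i, ∑ j ∈ P.nbr i, (if i ∈ (β ω).anchors ∧ j ∈ (β ω).nbrs i then
          (((β ω).nbrs i).card : ℝ)⁻¹ else 0) * F i j := fun ω => by
    rw [← Finset.sum_subset (Finset.subset_univ (β ω).anchors) fun i _ hi => by simp [hi]]
    refine Finset.sum_congr rfl fun i hi => ?_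
    rw [mean, Finset.mul_sum, ← Finset.sum_subset (h.nbrs_valid ω i hi).1
      fun j _ hj => by simp [hj]]
    refine Finset.sum_congr rfl fun j hj => ?_
    rw [if_pos ⟨hi, hj⟩]
  have hint : ∀ i j, Integrable (fun ω => (if i ∈ (β ω).anchors ∧ j ∈ (β ω).nbrs i then
          (((β ω).nbrs i).card : ℝ)⁻¹ else 0) * F i j) μ := fun i j =>
    integrable_comp_of_finite h.measurable fun b : Batch n =>
      (if i ∈ b.anchors ∧ j ∈ b.nbrs i then ((b.nbrs i).card : ℝ)⁻¹ else 0) * F i j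
  simp_rw [e]
  rw [integral_finsetSum _ fun i _ => integrable_finsetSum _ fun j _ => hint i j, Finset.mul_sum]
  refine Finset.sum_congr rfl fun i _ => ?_
  rw [integral_finsetSum _ fun j _ => hint i j, mean, Finset.mul_sum, Finset.mul_sum]
  refine Finset.sum_congr rfl fun j hj => ?_
  rw [integral_mul_const, h.nbrs_prob i j hj]
  ring

end Problem.IsUniformBatch

/-! ### Summation of the scalar recursions and choice of step sizes. -/

lemma average_le_of_summed_recursions {Sq Sg Sa Se T α γ δ η lo Δ Θ C₁ C₂ C₃ C₄ C₅ C₆ C₇ C₈ C₉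
    ρ : ℝ}
    (hT' : 0 < T) (hα : 0 < α) (hδ : 0 < δ) (hη : η < 1) (hlo : 0 < lo)
    (hΘ : 0 ≤ Θ) (hC₁ : 0 ≤ C₁) (hC₂ : 0 ≤ C₂) (hC₃ : 0 ≤ C₃) (hC₄ : 0 ≤ C₄) (hC₅ : 0 ≤ C₅)
    (hC₆ : 0 ≤ C₆) (hC₇ : 0 ≤ C₇) (hC₈ : 0 ≤ C₈) (hC₉ : 0 ≤ C₉)
    (R : α * Sq ≤ Δ + T * (C₁ * α ^ 2))
    (Q : (1 - η) * Sg ≤ (1 - η) * Sq + C₈ + T * (C₂ * α) + C₃ * Θ)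
    (G : lo / 2 * Sa ≤ Sg + C₄ * Se + T * (C₄ * C₅ * γ ^ 2))
    (Eb : δ * Se ≤ C₉ + T * (C₆ * (δ * γ) + C₇ * (α ^ 2 / δ)))
    (h1 : 1 / (α * T) = ρ) (h2 : α ≤ ρ) (h3 : 1 / T ≤ ρ) (h4 : γ ≤ ρ)
    (h5 : γ ^ 2 ≤ ρ) (h6 : 1 / (δ * T) ≤ 2 * ρ) (h7 : α ^ 2 / δ ^ 2 ≤ 4 * ρ) :
    1 / T * Sa ≤ 2 / lo * (Δ + C₁ + (C₈ + C₂ + C₃ * Θ) / (1 - η) + C₄ * (2 * C₉ + C₆ + 4 * C₇)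
      + C₄ * C₅) * ρ := by
  have hη' : 0 < 1 - η := by linarith
  have hρ : 0 ≤ ρ := (by positivity : 0 ≤ 1 / T).trans h3
  have R' : Sq / T ≤ (Δ + C₁) * ρ := by
    have e1 : Sq / T = (α * Sq) * (1 / (α * T)) := by field_simp
    have e2 : (Δ + T * (C₁ * α ^ 2)) * (1 / (α * T)) = Δ * (1 / (α * T)) + C₁ * α := by field_simp
    rw [e1]
    refine (mul_le_mul_of_nonneg_right R (by positivity)).trans ?_
    rw [e2, h1]
    nlinarith [mul_le_mul_of_nonneg_left h2 hC₁]
  have Q' : Sg / T ≤ Sq / T + (C₈ + C₂ + C₃ * Θ) / (1 - η) * ρ := by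
    have e1 : Sg / T = ((1 - η) * Sg) * (1 / ((1 - η) * T)) := by field_simp
    have e2 : ((1 - η) * Sq + C₈ + T * (C₂ * α) + C₃ * Θ) * (1 / ((1 - η) * T))
        = Sq / T + (C₈ * (1 / T) + C₂ * α + C₃ * Θ * (1 / T)) / (1 - η) := by field_simp; ring
    rw [e1]
    refine (mul_le_mul_of_nonneg_right Q (by positivity)).trans ?_
    rw [e2, div_mul_eq_mul_div]
    gcongr
    have := mul_le_mul_of_nonneg_left h3 hC₈
    have := mul_le_mul_of_nonneg_left h2 hC₂
    have := mul_le_mul_of_nonneg_left h3 (mul_nonneg hC₃ hΘ)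
    linarith
  have E' : Se / T ≤ (2 * C₉ + C₆ + 4 * C₇) * ρ := by
    have e1 : Se / T = (δ * Se) * (1 / (δ * T)) := by field_simp
    have e2 : (C₉ + T * (C₆ * (δ * γ) + C₇ * (α ^ 2 / δ))) * (1 / (δ * T))
        = C₉ * (1 / (δ * T)) + C₆ * γ + C₇ * (α ^ 2 / δ ^ 2) := by field_simp; ring
    rw [e1]
    refine (mul_le_mul_of_nonneg_right Eb (by positivity)).trans ?_
    rw [e2]
    have := mul_le_mul_of_nonneg_left h6 hC₉
    have := mul_le_mul_of_nonneg_left h4 hC₆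
    have := mul_le_mul_of_nonneg_left h7 hC₇
    linarith
  have G' : lo / 2 * (1 / T * Sa) ≤ Sg / T + C₄ * (Se / T) + C₄ * C₅ * γ ^ 2 := by
    have e1 : lo / 2 * (1 / T * Sa) = (lo / 2 * Sa) * (1 / T) := by ring
    have e2 : Sg / T + C₄ * (Se / T) + C₄ * C₅ * γ ^ 2
        = (Sg + C₄ * Se + T * (C₄ * C₅ * γ ^ 2)) * (1 / T) := by
      linear_combination (-(C₄ * C₅ * γ ^ 2)) * mul_one_div_cancel hT'.ne'
    rw [e1, e2]
    exact mul_le_mul_of_nonneg_right G (by positivity)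
  have hfin : lo / 2 * (1 / T * Sa) ≤ (Δ + C₁ + (C₈ + C₂ + C₃ * Θ) / (1 - η)
      + C₄ * (2 * C₉ + C₆ + 4 * C₇) + C₄ * C₅) * ρ := by
    have := mul_le_mul_of_nonneg_left E' hC₄
    have := mul_le_mul_of_nonneg_left h5 (mul_nonneg hC₄ hC₅)
    linarith
  calc 1 / T * Sa = 2 / lo * (lo / 2 * (1 / T * Sa)) := by field_simp
    _ ≤ 2 / lo * _ := mul_le_mul_of_nonneg_left hfin (by positivity)
    _ = _ := by ring

/-- Summation of the recursions satisfied by the objective `r`, the gradient-momentum correlation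
`q`, the preconditioner mass `s`, the squared gradient norm `a`, the tracking error `e` and the
estimated descent `g`. -/
lemma average_le_of_recursions {r q s a e g : ℕ → ℝ} {T : ℕ} (hT : 0 < T)
    {α γ δ η lo Δ Θ C₁ C₂ C₃ C₄ C₅ C₆ C₇ C₈ C₉ ρ : ℝ} (hα : 0 < α)
    (hδ : 0 < δ) (hη : η < 1) (hη₀ : 0 ≤ η) (hlo : 0 < lo)
    (hΘ : 0 ≤ Θ) (hC₁ : 0 ≤ C₁) (hC₂ : 0 ≤ C₂) (hC₃ : 0 ≤ C₃) (hC₄ : 0 ≤ C₄) (hC₅ : 0 ≤ C₅)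
    (hC₆ : 0 ≤ C₆) (hC₇ : 0 ≤ C₇) (hC₈ : 0 ≤ C₈) (hC₉ : 0 ≤ C₉)
    (hr : ∀ k, r (k + 1) ≤ r k - α * q (k + 1) + C₁ * α ^ 2)
    (hq : ∀ k, η * q k + (1 - η) * g k - C₂ * α - C₃ * (s k - s (k + 1)) ≤ q (k + 1))
    (hg : ∀ k, lo / 2 * a k - C₄ * (e k + C₅ * γ ^ 2) ≤ g k)
    (he : ∀ k, e (k + 1) ≤ (1 - δ) * e k + C₆ * (δ * γ) + C₇ * (α ^ 2 / δ))
    (hq₀ : q 0 = 0) (hqT : q T ≤ C₈) (hΔ : r 0 - r T ≤ Δ) (hs : s 0 - s T ≤ Θ) (he₀ : e 0 ≤ C₉)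
    (heT : 0 ≤ e T) (h1 : 1 / (α * T) = ρ) (h2 : α ≤ ρ) (h3 : 1 / (T : ℝ) ≤ ρ) (h4 : γ ≤ ρ)
    (h5 : γ ^ 2 ≤ ρ) (h6 : 1 / (δ * T) ≤ 2 * ρ) (h7 : α ^ 2 / δ ^ 2 ≤ 4 * ρ) :
    1 / (T : ℝ) * ∑ k ∈ Finset.range T, a k
      ≤ 2 / lo * (Δ + C₁ + (C₈ + C₂ + C₃ * Θ) / (1 - η) + C₄ * (2 * C₉ + C₆ + 4 * C₇)
        + C₄ * C₅) * ρ := by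
  have hT' : (0 : ℝ) < T := by exact_mod_cast hT
  have hη' : 0 < 1 - η := by linarith
  set Sq := ∑ k ∈ Finset.range T, q (k + 1) with hSq
  set Sg := ∑ k ∈ Finset.range T, g k with hSg
  set Sa := ∑ k ∈ Finset.range T, a k with hSa
  set Se := ∑ k ∈ Finset.range T, e k with hSe
  -- Since the momentum starts at zero, `q 0 = 0`, and the shifted and unshifted sums differ only in
  -- the last term.
  have hsumq : ∑ k ∈ Finset.range T, q k = Sq - q T := by
    have := Finset.sum_range_succ q T
    rw [Finset.sum_range_succ', hq₀] at this
    linarith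
  have hsume : ∑ k ∈ Finset.range T, e (k + 1) = Se + e T - e 0 := by
    have := Finset.sum_range_succ e T
    rw [Finset.sum_range_succ'] at this
    linarith
  have tele : ∀ f : ℕ → ℝ, ∑ k ∈ Finset.range T, (f k - f (k + 1)) = f 0 - f T :=
    fun f => Finset.sum_range_sub' f T
  have R : α * Sq ≤ Δ + T * (C₁ * α ^ 2) := by
    have := Finset.sum_le_sum fun k (_ : k ∈ Finset.range T) =>
      (show α * q (k + 1) ≤ (r k - r (k + 1)) + C₁ * α ^ 2 by linarith [hr k])
    rw [← Finset.mul_sum, Finset.sum_add_distrib, tele, Finset.sum_const, Finset.card_range,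
      nsmul_eq_mul] at this
    linarith
  have Q : (1 - η) * Sg ≤ (1 - η) * Sq + C₈ + T * (C₂ * α) + C₃ * Θ := by
    have := Finset.sum_le_sum fun k (_ : k ∈ Finset.range T) =>
      (show (1 - η) * g k ≤ q (k + 1) - η * q k + C₃ * (s k - s (k + 1)) + C₂ * α by
        linarith [hq k])
    rw [← Finset.mul_sum, Finset.sum_add_distrib, Finset.sum_add_distrib, Finset.sum_sub_distrib,
      ← Finset.mul_sum, ← Finset.mul_sum, tele, Finset.sum_const, Finset.card_range,
      nsmul_eq_mul, hsumq] at this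
    have h8 : η * q T ≤ C₈ := by nlinarith
    have h9 := mul_le_mul_of_nonneg_left hs hC₃
    linarith
  have G : lo / 2 * Sa ≤ Sg + C₄ * Se + T * (C₄ * C₅ * γ ^ 2) := by
    have := Finset.sum_le_sum fun k (_ : k ∈ Finset.range T) =>
      (show lo / 2 * a k ≤ g k + C₄ * e k + C₄ * C₅ * γ ^ 2 by linarith [hg k])
    rw [← Finset.mul_sum, Finset.sum_add_distrib, Finset.sum_add_distrib,
      ← Finset.mul_sum, Finset.sum_const, Finset.card_range, nsmul_eq_mul] at this
    linarith
  have Eb : δ * Se ≤ C₉ + T * (C₆ * (δ * γ) + C₇ * (α ^ 2 / δ)) := by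
    have := Finset.sum_le_sum fun k (_ : k ∈ Finset.range T) =>
      (show δ * e k ≤ (e k - e (k + 1)) + (C₆ * (δ * γ) + C₇ * (α ^ 2 / δ)) by linarith [he k])
    rw [← Finset.mul_sum, Finset.sum_add_distrib, tele, Finset.sum_const, Finset.card_range,
      nsmul_eq_mul] at this
    linarith
  exact average_le_of_summed_recursions hT' hα hδ hη hlo hΘ hC₁ hC₂ hC₃ hC₄ hC₅ hC₆ hC₇ hC₈ hC₉
    R Q G Eb h1 h2 h3 h4 h5 h6 h7

/-- Step sizes written through the fifth roots `N` and `X` of `n` and `T`. -/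
lemma exists_fifth_roots {n T : ℕ} (hn : 0 < n) (hT : n < T) :
    ∃ N X : ℝ, 1 ≤ N ∧ N ≤ X ∧ (n : ℝ) = N ^ 5 ∧ (T : ℝ) = X ^ 5 ∧
      (n : ℝ) ^ (2 / 5 : ℝ) = N ^ 2 ∧ (T : ℝ) ^ (2 / 5 : ℝ) = X ^ 2 ∧
      (T : ℝ) ^ (3 / 5 : ℝ) = X ^ 3 := by
  have hn1 : (1 : ℝ) ≤ n := by exact_mod_cast hn
  have hT1 : (n : ℝ) ≤ T := by exact_mod_cast hT.le
  refine ⟨(n : ℝ) ^ (1 / 5 : ℝ), (T : ℝ) ^ (1 / 5 : ℝ), Real.one_le_rpow hn1 (by norm_num),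
    Real.rpow_le_rpow (by positivity) hT1 (by norm_num), ?_, ?_, ?_, ?_, ?_⟩ <;>
  · rw [← Real.rpow_natCast, ← Real.rpow_mul (by positivity)]
    norm_num

lemma step_size_bounds {n T B : ℕ} (hB : 0 < B) (hBn : B ≤ n) (hT : n < T) {α γ δ ρ : ℝ}
    (hα : α = 1 / ((n : ℝ) ^ (2 / 5 : ℝ) * (T : ℝ) ^ (3 / 5 : ℝ)))
    (hγ : γ = (n : ℝ) ^ (2 / 5 : ℝ) / (T : ℝ) ^ (2 / 5 : ℝ))
    (hδ : δ = γ * B / (2 * n)) (hρ : ρ = (n : ℝ) ^ (2 / 5 : ℝ) / (T : ℝ) ^ (2 / 5 : ℝ)) :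
    0 < α ∧ 0 < γ ∧ γ ≤ 1 ∧ 0 < δ ∧ δ ≤ 1 ∧ 1 / (α * T) = ρ ∧ α ≤ ρ ∧ 1 / (T : ℝ) ≤ ρ ∧
      γ ≤ ρ ∧ γ ^ 2 ≤ ρ ∧ 1 / (δ * T) ≤ 2 * ρ ∧ α ^ 2 / δ ^ 2 ≤ 4 * ρ := by
  obtain ⟨N, X, hN, hNX, hnN, hTX, e1, e2, e3⟩ := exists_fifth_roots (hB.trans_le hBn) hT
  rw [e1, e3] at hα
  rw [e1, e2] at hγ hρ
  have hB1 : (1 : ℝ) ≤ B := by exact_mod_cast hB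
  have hBn' : (B : ℝ) ≤ n := by exact_mod_cast hBn
  have hN0 : 0 < N := by linarith
  have hX0 : 0 < X := by linarith
  have hX1 : 1 ≤ X := hN.trans hNX
  have hγ1 : γ ≤ 1 := by
    rw [hγ, div_le_one (by positivity)]
    exact pow_le_pow_left₀ hN0.le hNX 2
  have hγ0 : 0 < γ := by rw [hγ]; positivity
  have hn0 : (0 : ℝ) < n := by rw [hnN]; positivity
  -- The bounds on `1 / (δ T)` and `α² / δ²` use only the worst case `B = 1`, so the rate does not
  -- involve the batch size.
  have hδlo : γ / (2 * n) ≤ δ := by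
    rw [hδ]
    gcongr
    nlinarith
  have hδ0 : 0 < δ := lt_of_lt_of_le (by positivity) hδlo
  have hδ1 : δ ≤ 1 := by
    rw [hδ, div_le_one (by positivity)]
    nlinarith
  refine ⟨by rw [hα]; positivity, hγ0, hγ1, hδ0, hδ1, ?_, ?_, ?_, by rw [hγ, hρ], ?_, ?_, ?_⟩
  · rw [hα, hTX, hρ]; field_simp
  · rw [hα, hρ, div_le_div_iff₀ (by positivity) (by positivity)]
    have : 1 * X ^ 2 ≤ N ^ 4 * X ^ 3 :=
      mul_le_mul (one_le_pow₀ hN) (pow_le_pow_right₀ hX1 (by norm_num)) (by positivity)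
        (by positivity)
    linarith
  · rw [hTX, hρ, div_le_div_iff₀ (by positivity) (by positivity)]
    exact mul_le_mul (one_le_pow₀ hN) (pow_le_pow_right₀ hX1 (by norm_num)) (by positivity)
      (by positivity)
  · rw [hρ, ← hγ]; nlinarith
  -- This term is even `O((N / X) ^ 3)`; the next one, `α² / δ²`, balances the rate exactly.
  · calc 1 / (δ * T) ≤ 1 / (γ / (2 * n) * T) := by
          rw [hTX]; gcongr
      _ = 2 * (N ^ 3 / X ^ 3) := by rw [hγ, hnN, hTX]; field_simp
      _ = 2 * (N ^ 2 / X ^ 2 * (N / X)) := by field_simp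
      _ ≤ 2 * (N ^ 2 / X ^ 2 * 1) := by
          gcongr
          exact (div_le_one hX0).2 hNX
      _ = 2 * ρ := by rw [hρ]; ring
  · calc α ^ 2 / δ ^ 2 ≤ α ^ 2 / (γ / (2 * n)) ^ 2 := by gcongr
      _ = 4 * ρ := by rw [hα, hγ, hnN, hρ]; field_simp; norm_num

/-! ### Trajectories as functionals of the batches, and their expected recursions. -/

namespace Problem

variable {𝒳 : Type*} {df dc m C A n : ℕ} {P : Problem 𝒳 df dc m C A n}

/-- The moving averages `a`, `b` of numerators and denominators along the parameters `w`, as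
functionals of the batches. -/
structure IsTracking (P : Problem 𝒳 df dc m C A n) (K c γ v₀ : ℝ)
    (w : ℕ → (ℕ → Batch n) → P.Param) (a b : ℕ → (ℕ → Batch n) → Fin n → ℝ) : Prop where
  a_zero : ∀ β i, |a 0 β i| ≤ K
  b_zero : ∀ β i, |b 0 β i| ≤ K
  le_b_zero : ∀ β i, c ≤ b 0 β i
  a_succ : ∀ k β, a (k + 1) β = P.upA γ (β k) (w k β) (a k β)
  b_succ : ∀ k β, b (k + 1) β = P.upB γ v₀ (β k) (w k β) (b k β)

/-- Normalized form of a run of the algorithm as a functional of the batches: parameter `w`,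
momentum `h`, preconditioner `d`, and moving averages `a`, `b` of numerators and denominators. -/
structure IsTrajectory (P : Problem 𝒳 df dc m C A n) (K c α γ v₀ η lo hi Θ : ℝ) (w₁ : P.Param)
    (w h : ℕ → (ℕ → Batch n) → P.Param) (d : ℕ → (ℕ → Batch n) → P.variant.Idx → ℝ)
    (a b : ℕ → (ℕ → Batch n) → Fin n → ℝ) : Prop
    extends IsTracking P K c γ v₀ w a b where
  dep_w : ∀ k, DependsOn (w k) (Set.Iio k)
  dep_h : ∀ k, DependsOn (h k) (Set.Iio k)
  dep_d : ∀ k, DependsOn (d k) (Set.Iio k)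
  dep_a : ∀ k, DependsOn (a k) (Set.Iio k)
  dep_b : ∀ k, DependsOn (b k) (Set.Iio k)
  w_zero : ∀ β, w 0 β = w₁
  h_zero : ∀ β, h 0 β = 0
  h_succ : ∀ k β, h (k + 1) β
    = η • h k β + (1 - η) • P.gest (β k) (w k β) (a (k + 1) β) (b (k + 1) β)
  w_succ : ∀ k β, w (k + 1) β = w k β - α • diag (d (k + 1) β) (h (k + 1) β)
  le_d : ∀ β, (∀ k, P.Valid (β k)) → ∀ k l, lo ≤ d k β l
  d_le : ∀ β, (∀ k, P.Valid (β k)) → ∀ k l, d k β l ≤ hi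
  d_succ_le : ∀ β, (∀ k, P.Valid (β k)) → ∀ k l, d (k + 1) β l ≤ d k β l
  mass : ∀ β, (∀ k, P.Valid (β k)) → ∀ k, ∑ l, d 0 β l - ∑ l, d k β l ≤ Θ

/-- The bound on the gradient estimator. -/
def gradBound (K D c : ℝ) : ℝ := c⁻¹ * D + K / c ^ 2 * D

/-- The constant of the convergence rate. -/
def rateConst (K D L c lo hi Θ η Δ : ℝ) : ℝ :=
  let Γ := gradBound K D c
  let DR := K * ((c ^ 2)⁻¹ * D) + c⁻¹ * D
  let LR := K * ((c ^ 2)⁻¹ * L + 2 / c ^ 3 * D ^ 2) + c⁻¹ * L + 2 * (D * ((c ^ 2)⁻¹ * D))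
  2 / lo * (Δ + 2 * LR * (hi * Γ) ^ 2
    + (DR * (hi * Γ) + LR * (hi * Γ) ^ 2 + DR * Γ * Θ) / (1 - η)
    + descentCoef K D c lo hi * (2 * (8 * K ^ 2) + 32 * K ^ 2 + 4 * (4 * D ^ 2 * (hi * Γ) ^ 2))
    + descentCoef K D c lo hi * (16 * K ^ 2))

namespace IsTracking

variable {K D L c γ v₀ : ℝ} {w : ℕ → (ℕ → Batch n) → P.Param}
  {a b : ℕ → (ℕ → Batch n) → Fin n → ℝ}

lemma abs_a_le (ht : P.IsTracking K c γ v₀ w a b) (hP : P.Good K D L c)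
    (h₀ : 0 ≤ γ) (h₁ : γ ≤ 1) {β : ℕ → Batch n} (hβ : ∀ k, P.Valid (β k)) (k : ℕ) (i : Fin n) :
    |a k β i| ≤ K := by
  induction k generalizing i with
  | zero => exact ht.a_zero β i
  | succ k ih => rw [ht.a_succ]; exact hP.abs_upA_le (hβ k) h₀ h₁ ih _ i

lemma le_b (ht : P.IsTracking K c γ v₀ w a b) (hP : P.Good K D L c)
    (h₀ : 0 ≤ γ) (h₁ : γ ≤ 1) {β : ℕ → Batch n} (hβ : ∀ k, P.Valid (β k)) (k : ℕ) (i : Fin n) :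
    c ≤ b k β i := by
  induction k generalizing i with
  | zero => exact ht.le_b_zero β i
  | succ k ih => rw [ht.b_succ]; exact hP.le_upB (hβ k) h₀ h₁ ih v₀ _ i

lemma norm_gest_le (ht : P.IsTracking K c γ v₀ w a b) (hP : P.Good K D L c)
    (h₀ : 0 ≤ γ) (h₁ : γ ≤ 1) {β : ℕ → Batch n} (hβ : ∀ k, P.Valid (β k)) (k : ℕ) :
    ‖P.gest (β k) (w k β) (a (k + 1) β) (b (k + 1) β)‖ ≤ gradBound K D c :=
  hP.norm_gest_le (hβ k) _ (ht.abs_a_le hP h₀ h₁ hβ (k + 1))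
    fun i _ => ht.le_b hP h₀ h₁ hβ (k + 1) i

end IsTracking

namespace IsTrajectory

variable {K D L c α γ v₀ η lo hi Θ : ℝ} {w₁ : P.Param}
  {w h : ℕ → (ℕ → Batch n) → P.Param} {d : ℕ → (ℕ → Batch n) → P.variant.Idx → ℝ}
  {a b : ℕ → (ℕ → Batch n) → Fin n → ℝ}

lemma norm_h_le (ht : P.IsTrajectory K c α γ v₀ η lo hi Θ w₁ w h d a b) (hP : P.Good K D L c)
    (h₀ : 0 ≤ γ) (h₁ : γ ≤ 1) (hη₀ : 0 ≤ η) (hη₁ : η ≤ 1) (hΓ : 0 ≤ gradBound K D c)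
    {β : ℕ → Batch n} (hβ : ∀ k, P.Valid (β k)) (k : ℕ) : ‖h k β‖ ≤ gradBound K D c := by
  induction k with
  | zero => rwa [ht.h_zero, norm_zero]
  | succ k ih =>
    have hG := ht.norm_gest_le hP h₀ h₁ hβ k
    rw [ht.h_succ]
    refine (norm_add_le _ _).trans ?_
    rw [norm_smul, norm_smul, Real.norm_of_nonneg hη₀, Real.norm_of_nonneg (sub_nonneg.2 hη₁)]
    nlinarith [mul_le_mul_of_nonneg_left hG (sub_nonneg.2 hη₁),
      mul_le_mul_of_nonneg_left ih hη₀]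

variable {Ω : Type*} [MeasurableSpace Ω] {μ : Measure Ω} [IsProbabilityMeasure μ] {B : ℕ}
  {β : ℕ → Ω → Batch n}

/-- Expected lower bound for the decrease achieved by the gradient estimator. -/
lemma integral_estimated_descent_ge (ht : P.IsTrajectory K c α γ v₀ η lo hi Θ w₁ w h d a b)
    (hP : P.Good K D L c) (hn : 0 < n) (hB : 0 < B) (h₀ : 0 ≤ γ) (h₁ : γ ≤ 1) (hlo : 0 < lo)
    (hhi : 0 ≤ hi) (hv₀ : ∀ i w, v₀ ≤ P.qhat i (P.nbr i) w)
    (hβ : ∀ k, P.IsUniformBatch μ B (β k)) (hind : iIndepFun β μ) (k : ℕ) :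
    lo / 2 * ∫ ω, ‖gradient P.R (w k fun j => β j ω)‖ ^ 2 ∂μ
        - descentCoef K D c lo hi * (∫ ω, P.merr (w k fun j => β j ω) (a k fun j => β j ω)
          (b k fun j => β j ω) ∂μ + 16 * K ^ 2 * γ ^ 2)
      ≤ ∫ ω, inner ℝ (gradient P.R (w k fun j => β j ω)) (diag (d k fun j => β j ω)
          (P.gest (β k ω) (w k fun j => β j ω) (a (k + 1) fun j => β j ω)
            (b (k + 1) fun j => β j ω))) ∂μ := by
  have hm : ∀ k, Measurable (β k) := fun k => (hβ k).measurable
  have hval : ∀ ω, ∀ k, P.Valid (β k ω) := fun ω k => (hβ k).valid hB ω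
  set X := descentCoef K D c lo hi with hX
  set E := 16 * K ^ 2 * γ ^ 2 with hE
  -- The updated averages are unfolded through `upA` and `upB`, separating the past `p` from the
  -- current batch `x`.
  let F : (ℕ → Batch n) → Batch n → ℝ := fun p x =>
    inner ℝ (gradient P.R (w k p)) (diag (d k p)
      (P.gest x (w k p) (P.upA γ x (w k p) (a k p)) (P.upB γ v₀ x (w k p) (b k p))))
  have hF : DependsOn F (Set.Iio k) := fun p p' hp => by
    simp only [F, ht.dep_w k hp, ht.dep_d k hp, ht.dep_a k hp, ht.dep_b k hp]
  let H : (ℕ → Batch n) → ℝ := fun p => lo / 2 * ‖gradient P.R (w k p)‖ ^ 2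
    - X * (P.merr (w k p) (a k p) (b k p) + E)
  have hH : DependsOn H (Set.Iio k) := fun p p' hp => by
    simp only [H, ht.dep_w k hp, ht.dep_a k hp, ht.dep_b k hp]
  have hinner : ∀ ω, H (fun j => β j ω) ≤ ∫ ω', F (fun j => β j ω) (β k ω') ∂μ := fun ω => by
    set p : ℕ → Batch n := fun j => β j ω with hp
    set v := diag (d k p) (gradient P.R (w k p)) with hv
    set J := P.descentPart lo X (w k p) v (a k p) (b k p) E with hJ
    have hle : ∀ ω', (B : ℝ)⁻¹ * ∑ i ∈ (β k ω').anchors, mean ((β k ω').nbrs i) (J i)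
        ≤ F p (β k ω') := fun ω' => by
      have := hP.descentPart_le (hval ω' k) h₀ h₁ (a := a k p)
        (ht.le_b hP h₀ h₁ (hval ω) k) (w k p) (fun i => hv₀ i _) hlo
        (ht.le_d p (hval ω) k) (ht.d_le p (hval ω) k) hhi
      rwa [mean, (hβ k).card ω'] at this
    have hlow : H p ≤ ∫ ω', (B : ℝ)⁻¹ * ∑ i ∈ (β k ω').anchors,
        mean ((β k ω').nbrs i) (J i) ∂μ := by
      have hB' : (B : ℝ) ≠ 0 := by exact_mod_cast hB.ne'
      have hn' : (n : ℝ) ≠ 0 := by exact_mod_cast hn.ne'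
      have e : (B : ℝ)⁻¹ * ((B : ℝ) / n * ∑ i, mean (P.nbr i) (J i))
          = mean Finset.univ fun i => mean (P.nbr i) (J i) := by
        rw [mean, Finset.card_univ, Fintype.card_fin]
        field_simp
      rw [integral_const_mul, (hβ k).integral_sum_mean, e, hJ, hP.mean_mean_descentPart hn,
        ← inner_gradient_left]
      have := le_inner_diag_self (gradient P.R (w k p)) (ht.le_d p (hval ω) k)
      simp only [H]
      linarith
    refine hlow.trans (integral_mono ?_ ?_ hle)
    · exact integrable_comp_of_finite (hm k) fun x : Batch n =>
        (B : ℝ)⁻¹ * ∑ i ∈ x.anchors, mean (x.nbrs i) (J i)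
    · exact integrable_comp_of_finite (hm k) (F p)
  have hfresh := integral_eq_integral_integral_fresh hm hind hF
  have hlhs : ∫ ω, H (fun j => β j ω) ∂μ = lo / 2 * ∫ ω, ‖gradient P.R (w k fun j => β j ω)‖ ^ 2 ∂μ
      - X * (∫ ω, P.merr (w k fun j => β j ω) (a k fun j => β j ω) (b k fun j => β j ω) ∂μ
        + E) := by
    have i1 : Integrable (fun ω => ‖gradient P.R (w k fun j => β j ω)‖ ^ 2) μ :=
      integrable_of_dependsOn hm (k := k) (F := fun p => ‖gradient P.R (w k p)‖ ^ 2)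
        fun p p' hp => by simp only [ht.dep_w k hp]
    have i2 : Integrable (fun ω => P.merr (w k fun j => β j ω) (a k fun j => β j ω)
        (b k fun j => β j ω)) μ :=
      integrable_of_dependsOn hm (k := k) (F := fun p => P.merr (w k p) (a k p) (b k p))
        fun p p' hp => by simp only [ht.dep_w k hp, ht.dep_a k hp, ht.dep_b k hp]
    have i3 : Integrable (fun ω => P.merr (w k fun j => β j ω) (a k fun j => β j ω)
        (b k fun j => β j ω) + E) μ := i2.add (integrable_const E)
    simp only [H]
    rw [integral_sub (i1.const_mul _) (i3.const_mul X), integral_const_mul,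
      integral_const_mul, integral_add i2 (integrable_const E)]
    simp
  rw [← hlhs]
  simp only [ht.a_succ, ht.b_succ]
  refine le_trans ?_ hfresh.symm.le
  refine integral_mono (integrable_of_dependsOn hm hH) ?_ hinner
  exact integrable_of_dependsOn hm (k := k) (F := fun p => ∫ ω', F p (β k ω') ∂μ)
    fun p p' hp => by simp only [hF hp]

/-- Expected contraction of the tracking error. -/
lemma integral_merr_succ_le (ht : P.IsTrajectory K c α γ v₀ η lo hi Θ w₁ w h d a b)
    (hP : P.Good K D L c) (hn : 0 < n) (hB : 0 < B) (h₀ : 0 ≤ γ) (h₁ : γ ≤ 1) {δ : ℝ}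
    (hδ : δ = γ * B / (2 * n)) (hδ₀ : 0 < δ) (hδ₁ : δ ≤ 1) (hα : 0 ≤ α) (hlo : 0 < lo)
    (hhi : 0 ≤ hi) (hη₀ : 0 ≤ η) (hη₁ : η ≤ 1) (hΓ : 0 ≤ gradBound K D c)
    (hv₀ : ∀ i w, v₀ ≤ P.qhat i (P.nbr i) w)
    (hβ : ∀ k, P.IsUniformBatch μ B (β k)) (hind : iIndepFun β μ) (k : ℕ) :
    ∫ ω, P.merr (w (k + 1) fun j => β j ω) (a (k + 1) fun j => β j ω)
          (b (k + 1) fun j => β j ω) ∂μ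
      ≤ (1 - δ) * ∫ ω, P.merr (w k fun j => β j ω) (a k fun j => β j ω) (b k fun j => β j ω) ∂μ
        + 32 * K ^ 2 * (δ * γ) + 4 * D ^ 2 * (hi * gradBound K D c) ^ 2 * (α ^ 2 / δ) := by
  have hm : ∀ k, Measurable (β k) := fun k => (hβ k).measurable
  have hval : ∀ ω, ∀ k, P.Valid (β k ω) := fun ω k => (hβ k).valid hB ω
  have : Nonempty (Fin n) := ⟨⟨0, hn⟩⟩
  set ρ := hi * gradBound K D c with hρ
  let F : (ℕ → Batch n) → Batch n → ℝ := fun p x =>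
    P.merr (w k p) (P.upA γ x (w k p) (a k p)) (P.upB γ v₀ x (w k p) (b k p))
  have hF : DependsOn F (Set.Iio k) := fun p p' hp => by
    simp only [F, ht.dep_w k hp, ht.dep_a k hp, ht.dep_b k hp]
  let M : (ℕ → Batch n) → ℝ := fun p => P.merr (w k p) (a k p) (b k p)
  have hM : DependsOn M (Set.Iio k) := fun p p' hp => by
    simp only [M, ht.dep_w k hp, ht.dep_a k hp, ht.dep_b k hp]
  have iM := integrable_of_dependsOn (μ := μ) hm hM
  have hinner : ∀ ω, ∫ ω', F (fun j => β j ω) (β k ω') ∂μ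
      ≤ (1 - 2 * δ) * M (fun j => β j ω) + 16 * K ^ 2 * (δ * γ) := fun ω => by
    set p : ℕ → Batch n := fun j => β j ω with hp
    set J := P.errPart γ K (w k p) (a k p) (b k p) with hJ
    have hle : ∀ ω', F p (β k ω') ≤ M p
        + (n : ℝ)⁻¹ * ∑ i ∈ (β k ω').anchors, mean ((β k ω').nbrs i) (J i) := fun ω' =>
      hP.merr_update_le (hval ω' k) h₀ h₁ _ _ _ fun i => hv₀ i _
    have iJ : Integrable (fun ω' => (n : ℝ)⁻¹ * ∑ i ∈ (β k ω').anchors,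
        mean ((β k ω').nbrs i) (J i)) μ :=
      integrable_comp_of_finite (hm k) fun x : Batch n =>
        (n : ℝ)⁻¹ * ∑ i ∈ x.anchors, mean (x.nbrs i) (J i)
    refine (integral_mono (integrable_comp_of_finite (hm k) (F p))
      ((integrable_const _).add iJ) hle).trans ?_
    have hn' : (n : ℝ) ≠ 0 := by exact_mod_cast hn.ne'
    have e : (n : ℝ)⁻¹ * ((B : ℝ) / n * ∑ i, mean (P.nbr i) (J i))
        = (B : ℝ) / n * (8 * K ^ 2 * γ ^ 2 - γ * M p) := by
      have e1 : mean Finset.univ (fun i => mean (P.nbr i) (J i))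
          = 8 * K ^ 2 * γ ^ 2 - γ * M p := by
        simp only [hJ, mean_mean_errPart hP.nbr_nonempty]
        rw [mean_sub, mean_const Finset.univ_nonempty, mean_const_mul]
        rfl
      rw [← e1, mean, Finset.card_univ, Fintype.card_fin]
      ring
    have e2 : ∫ ω', (M p + (n : ℝ)⁻¹ * ∑ i ∈ (β k ω').anchors,
        mean ((β k ω').nbrs i) (J i)) ∂μ = M p + (B : ℝ) / n * (8 * K ^ 2 * γ ^ 2 - γ * M p) := by
      rw [integral_add (integrable_const _) iJ, integral_const_mul, (hβ k).integral_sum_mean, e]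
      simp
    refine e2.le.trans (le_of_eq ?_)
    rw [hδ]
    field_simp
    ring
  have hfresh := integral_eq_integral_integral_fresh hm hind hF
  have hmid : ∫ ω, F (fun j => β j ω) (β k ω) ∂μ
      ≤ (1 - 2 * δ) * ∫ ω, M (fun j => β j ω) ∂μ + 16 * K ^ 2 * (δ * γ) := by
    rw [hfresh]
    have hD : DependsOn (fun p => ∫ ω', F p (β k ω') ∂μ) (Set.Iio k) :=
      fun p p' hp => by simp only [hF hp]
    refine (integral_mono (integrable_of_dependsOn hm hD)
      ((iM.const_mul _).add (integrable_const _)) hinner).trans (le_of_eq ?_)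
    rw [integral_add' (iM.const_mul _) (integrable_const _), integral_const_mul]
    simp
  -- After substituting the current batch the functional sees batch `k`, so it depends on one more
  -- index.
  have hF' : DependsOn (fun p => F p (p k)) (Set.Iio (k + 1)) := fun p p' hp => by
    have h1 : F p = F p' := hF fun i hi => hp i (Nat.lt_succ_of_lt hi)
    simp only [h1, hp k (Nat.lt_succ_self k)]
  have iF := integrable_of_dependsOn (μ := μ) hm hF'
  have hpath : ∀ ω, P.merr (w (k + 1) fun j => β j ω) (a (k + 1) fun j => β j ω)
      (b (k + 1) fun j => β j ω) ≤ (1 + δ) * F (fun j => β j ω) (β k ω)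
        + (1 + δ⁻¹) * (2 * D ^ 2 * (α * ρ) ^ 2) := fun ω => by
    set p : ℕ → Batch n := fun j => β j ω with hp
    have hz : ‖diag (d (k + 1) p) (h (k + 1) p)‖ ≤ ρ :=
      (norm_diag_le _ (fun l => hlo.le.trans (ht.le_d p (hval ω) _ l)) (ht.d_le p (hval ω) _)
        hhi).trans (by
          rw [hρ]
          gcongr
          exact ht.norm_h_le hP h₀ h₁ hη₀ hη₁ hΓ (hval ω) _)
    have hn' : ‖w (k + 1) p - w k p‖ ≤ α * ρ := by
      rw [ht.w_succ, sub_sub_cancel_left, norm_neg, norm_smul, Real.norm_of_nonneg hα]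
      gcongr
    refine (hP.merr_drift_le hδ₀ _ _ (w k p) (w (k + 1) p) hn).trans ?_
    have e : P.merr (w k p) (a (k + 1) p) (b (k + 1) p) = F p (β k ω) := by
      rw [ht.a_succ, ht.b_succ]
    rw [e]
    gcongr
  have hd : DependsOn (fun p => P.merr (w (k + 1) p) (a (k + 1) p) (b (k + 1) p))
      (Set.Iio (k + 1)) := fun p p' hp => by
    simp only [ht.dep_w _ hp, ht.dep_a _ hp, ht.dep_b _ hp]
  have hfin := integral_mono (integrable_of_dependsOn (μ := μ) hm hd)
    ((iF.const_mul (1 + δ)).add (integrable_const ((1 + δ⁻¹) * (2 * D ^ 2 * (α * ρ) ^ 2)))) hpath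
  have e3 : ∫ ω, ((1 + δ) * F (fun j => β j ω) (β k ω)
        + (1 + δ⁻¹) * (2 * D ^ 2 * (α * ρ) ^ 2)) ∂μ
      = (1 + δ) * ∫ ω, F (fun j => β j ω) (β k ω) ∂μ
        + (1 + δ⁻¹) * (2 * D ^ 2 * (α * ρ) ^ 2) := by
    rw [integral_add (iF.const_mul _) (integrable_const _), integral_const_mul]
    simp
  refine (hfin.trans e3.le).trans ?_
  have hM0 : 0 ≤ ∫ ω, M (fun j => β j ω) ∂μ := integral_nonneg fun ω => by
    simp only [M, merr, mean, err]
    positivity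
  set I := ∫ ω, M (fun j => β j ω) ∂μ with hI
  change _ ≤ (1 - δ) * I + _ + _
  have h5 := mul_le_mul_of_nonneg_left hmid (by linarith : 0 ≤ 1 + δ)
  -- A refresh contracts by `1 - γ B / n = 1 - 2 δ`; the drift factor `1 + δ` returns half of that
  -- gain.
  have h6 : (1 + δ) * ((1 - 2 * δ) * I) ≤ (1 - δ) * I := by
    nlinarith [mul_nonneg hδ₀.le hM0, sq_nonneg δ]
  have h7 : (1 + δ) * (16 * K ^ 2 * (δ * γ)) ≤ 2 * (16 * K ^ 2 * (δ * γ)) := by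
    gcongr
    linarith
  have h8 : (1 + δ⁻¹) * (2 * D ^ 2 * (α * ρ) ^ 2) ≤ (2 * δ⁻¹) * (2 * D ^ 2 * (α * ρ) ^ 2) := by
    gcongr
    have := (one_le_inv₀ hδ₀).2 hδ₁
    linarith
  have e4 : (2 * δ⁻¹) * (2 * D ^ 2 * (α * ρ) ^ 2) = 4 * D ^ 2 * ρ ^ 2 * (α ^ 2 / δ) := by
    field_simp; ring
  linarith

end IsTrajectory
end Problem

/-! ### The convergence rate for trajectories. -/

namespace Problem.IsTrajectory

variable {𝒳 : Type*} {df dc m C A n : ℕ} {P : Problem 𝒳 df dc m C A n}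
  {K D L c α γ v₀ η lo hi Θ : ℝ} {w₁ : P.Param}
  {w h : ℕ → (ℕ → Batch n) → P.Param} {d : ℕ → (ℕ → Batch n) → P.variant.Idx → ℝ}
  {a b : ℕ → (ℕ → Batch n) → Fin n → ℝ}
  {Ω : Type*} [MeasurableSpace Ω] {μ : Measure Ω} [IsProbabilityMeasure μ] {B : ℕ}
  {β : ℕ → Ω → Batch n}

lemma integrable_average (ht : P.IsTrajectory K c α γ v₀ η lo hi Θ w₁ w h d a b)
    (hm : ∀ k, Measurable (β k)) (T : ℕ) :
    Integrable (fun ω => 1 / (T : ℝ) * ∑ k ∈ Finset.range T,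
      ‖gradient P.R (w k fun j => β j ω)‖ ^ 2) μ :=
  (integrable_finsetSum _ fun k _ => integrable_of_dependsOn hm (k := k)
    (F := fun p => ‖gradient P.R (w k p)‖ ^ 2)
    fun p p' hp => by simp only [ht.dep_w k hp]).const_mul _

/-- The pathwise inequalities `step_le` and `momentum_ge` are integrated and combined with the two
expected bounds; the resulting deterministic sequences are fed to `average_le_of_recursions`. -/
theorem integral_average_le (ht : P.IsTrajectory K c α γ v₀ η lo hi Θ w₁ w h d a b)
    (hP : P.Good K D L c) {T : ℕ} (hT : n < T) (hB : 0 < B)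
    (hα : α = 1 / ((n : ℝ) ^ (2 / 5 : ℝ) * (T : ℝ) ^ (3 / 5 : ℝ)))
    (hγ : γ = (n : ℝ) ^ (2 / 5 : ℝ) / (T : ℝ) ^ (2 / 5 : ℝ)) (hlo : 0 < lo) (hhi : 0 ≤ hi)
    (hη₀ : 0 ≤ η) (hη₁ : η < 1) (hΘ : 0 ≤ Θ) {Δ : ℝ} (hΔ : ∀ w, P.R w₁ - P.R w ≤ Δ)
    (hv₀ : ∀ i w, v₀ ≤ P.qhat i (P.nbr i) w)
    (hβ : ∀ k, P.IsUniformBatch μ B (β k)) (hind : iIndepFun β μ) :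
    ∫ ω, 1 / (T : ℝ) * ∑ k ∈ Finset.range T, ‖gradient P.R (w k fun j => β j ω)‖ ^ 2 ∂μ
      ≤ rateConst K D L c lo hi Θ η Δ
        * ((n : ℝ) ^ (2 / 5 : ℝ) / (T : ℝ) ^ (2 / 5 : ℝ)) := by
  have hm : ∀ k, Measurable (β k) := fun k => (hβ k).measurable
  have hval : ∀ ω, ∀ k, P.Valid (β k ω) := fun ω k => (hβ k).valid hB ω
  have hBn : B ≤ n := (hβ 0).le_card
  have hn : 0 < n := hB.trans_le hBn
  obtain ⟨hα₀, hγ₀, hγ₁, hδ₀, hδ₁, s1, s2, s3, s4, s5, s6, s7⟩ :=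
    step_size_bounds hB hBn hT hα hγ rfl rfl
  have hR := hP.R_smooth hn
  set DR := K * ((c ^ 2)⁻¹ * D) + c⁻¹ * D with hDR
  set LR := K * ((c ^ 2)⁻¹ * L + 2 / c ^ 3 * D ^ 2) + c⁻¹ * L + 2 * (D * ((c ^ 2)⁻¹ * D))
    with hLR
  have hi₀ := hP.pw_smooth ⟨0, hn⟩ _ (hP.nbr_nonempty ⟨0, hn⟩).choose_spec
  have hK := hi₀.nonneg_bdd
  have hD := hi₀.nonneg_fderiv_bdd
  have hc := hP.c_pos
  have hL := hP.L_nonneg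
  have hΓ : 0 ≤ gradBound K D c := by unfold gradBound; positivity
  set Γ := gradBound K D c with hΓdef
  have hDR₀ : 0 ≤ DR := by positivity
  have hLR₀ : 0 ≤ LR := by positivity
  have hcoef : 0 ≤ descentCoef K D c lo hi := by unfold descentCoef; positivity
  have hz : ∀ ω k, ‖diag (d k fun j => β j ω) (h k fun j => β j ω)‖ ≤ hi * Γ := fun ω k =>
    (norm_diag_le _ (fun l => hlo.le.trans (ht.le_d _ (hval ω) _ l)) (ht.d_le _ (hval ω) _)
      hhi).trans (by gcongr; exact ht.norm_h_le hP hγ₀.le hγ₁ hη₀ hη₁.le hΓ (hval ω) _)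
  have ir : ∀ k, Integrable (fun ω => P.R (w k fun j => β j ω)) μ := fun k =>
    integrable_of_dependsOn hm (k := k) (F := fun p => P.R (w k p))
      fun p p' hp => by simp only [ht.dep_w k hp]
  have iq : ∀ k, Integrable (fun ω => (inner ℝ (gradient P.R (w k fun j => β j ω))
      (diag (d k fun j => β j ω) (h k fun j => β j ω)) : ℝ)) μ := fun k =>
    integrable_of_dependsOn hm (k := k)
      (F := fun p => inner ℝ (gradient P.R (w k p)) (diag (d k p) (h k p)))
      fun p p' hp => by simp only [ht.dep_w k hp, ht.dep_d k hp, ht.dep_h k hp]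
  have is : ∀ k, Integrable (fun ω => ∑ l, d k (fun j => β j ω) l) μ := fun k =>
    integrable_of_dependsOn hm (k := k) (F := fun p => ∑ l, d k p l)
      fun p p' hp => by simp only [ht.dep_d k hp]
  have ia : ∀ k, Integrable (fun ω => ‖gradient P.R (w k fun j => β j ω)‖ ^ 2) μ := fun k =>
    integrable_of_dependsOn hm (k := k) (F := fun p => ‖gradient P.R (w k p)‖ ^ 2)
      fun p p' hp => by simp only [ht.dep_w k hp]
  have ie : ∀ k, Integrable (fun ω => P.merr (w k fun j => β j ω) (a k fun j => β j ω)
      (b k fun j => β j ω)) μ := fun k =>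
    integrable_of_dependsOn hm (k := k) (F := fun p => P.merr (w k p) (a k p) (b k p))
      fun p p' hp => by simp only [ht.dep_w k hp, ht.dep_a k hp, ht.dep_b k hp]
  have ig : ∀ k, Integrable (fun ω => (inner ℝ (gradient P.R (w k fun j => β j ω))
      (diag (d k fun j => β j ω) (P.gest (β k ω) (w k fun j => β j ω)
        (a (k + 1) fun j => β j ω) (b (k + 1) fun j => β j ω))) : ℝ)) μ := fun k =>
    integrable_of_dependsOn hm (k := k + 1)
      (F := fun p => inner ℝ (gradient P.R (w k p)) (diag (d k p)
        (P.gest (p k) (w k p) (a (k + 1) p) (b (k + 1) p))))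
      fun p p' hp => by
        have hp' : ∀ i ∈ Set.Iio k, p i = p' i := fun i hi => hp i (Nat.lt_succ_of_lt hi)
        simp only [ht.dep_w k hp', ht.dep_d k hp', ht.dep_a _ hp, ht.dep_b _ hp,
          hp k (Nat.lt_succ_self k)]
  rw [integral_const_mul, integral_finsetSum _ fun k _ => ia k]
  refine average_le_of_recursions (T := T) (hn.trans hT)
    (r := fun k => ∫ ω, P.R (w k fun j => β j ω) ∂μ)
    (q := fun k => ∫ ω, inner ℝ (gradient P.R (w k fun j => β j ω))
      (diag (d k fun j => β j ω) (h k fun j => β j ω)) ∂μ)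
    (s := fun k => ∫ ω, ∑ l, d k (fun j => β j ω) l ∂μ)
    (a := fun k => ∫ ω, ‖gradient P.R (w k fun j => β j ω)‖ ^ 2 ∂μ)
    (e := fun k => ∫ ω, P.merr (w k fun j => β j ω) (a k fun j => β j ω)
      (b k fun j => β j ω) ∂μ)
    (g := fun k => ∫ ω, inner ℝ (gradient P.R (w k fun j => β j ω)) (diag (d k fun j => β j ω)
          (P.gest (β k ω) (w k fun j => β j ω) (a (k + 1) fun j => β j ω)
            (b (k + 1) fun j => β j ω))) ∂μ)
    (α := α) (γ := γ) (δ := γ * B / (2 * n)) (η := η) (lo := lo) (Δ := Δ) (Θ := Θ)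
    (C₁ := 2 * LR * (hi * Γ) ^ 2) (C₂ := LR * (hi * Γ) ^ 2) (C₃ := DR * Γ)
    (C₄ := descentCoef K D c lo hi) (C₅ := 16 * K ^ 2) (C₆ := 32 * K ^ 2)
    (C₇ := 4 * D ^ 2 * (hi * Γ) ^ 2) (C₈ := DR * (hi * Γ)) (C₉ := 8 * K ^ 2)
    hα₀ hδ₀ hη₁ hη₀ hlo hΘ (by positivity) (by positivity) (by positivity) hcoef (by positivity)
    (by positivity) (by positivity) (by positivity) (by positivity)
    (fun k => ?_) (fun k => ?_) (fun k => ?_) (fun k => ?_) ?_ ?_ ?_ ?_ ?_ ?_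
    s1 s2 s3 s4 s5 s6 s7
  · have hpath : ∀ ω, P.R (w (k + 1) fun j => β j ω) ≤ P.R (w k fun j => β j ω)
        - α * inner ℝ (gradient P.R (w (k + 1) fun j => β j ω))
          (diag (d (k + 1) fun j => β j ω) (h (k + 1) fun j => β j ω))
        + 2 * LR * (hi * Γ) ^ 2 * α ^ 2 := fun ω =>
      hR.step_le hLR₀ hα₀.le (ht.w_succ k _) (hz ω (k + 1))
    refine (integral_mono (ir _) (((ir k).sub ((iq (k + 1)).const_mul α)).add
      (integrable_const _)) hpath).trans (le_of_eq ?_)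
    rw [integral_add' ((ir k).sub ((iq (k + 1)).const_mul α)) (integrable_const _),
      integral_sub' (ir k) ((iq (k + 1)).const_mul α), integral_const_mul]
    simp
  · have hpath : ∀ ω, η * inner ℝ (gradient P.R (w k fun j => β j ω))
          (diag (d k fun j => β j ω) (h k fun j => β j ω))
        + (1 - η) * inner ℝ (gradient P.R (w k fun j => β j ω)) (diag (d k fun j => β j ω)
          (P.gest (β k ω) (w k fun j => β j ω) (a (k + 1) fun j => β j ω)
            (b (k + 1) fun j => β j ω)))
        - LR * (hi * Γ) ^ 2 * α
        - DR * Γ * (∑ l, d k (fun j => β j ω) l - ∑ l, d (k + 1) (fun j => β j ω) l)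
        ≤ inner ℝ (gradient P.R (w (k + 1) fun j => β j ω))
          (diag (d (k + 1) fun j => β j ω) (h (k + 1) fun j => β j ω)) := fun ω =>
      hR.momentum_ge hLR₀ hα₀.le (ht.w_succ k _) (ht.h_succ k _) (hz ω (k + 1))
        (ht.norm_h_le hP hγ₀.le hγ₁ hη₀ hη₁.le hΓ (hval ω) _) (ht.d_succ_le _ (hval ω) k)
    have i1 := ((iq k).const_mul η).add ((ig k).const_mul (1 - η))
    have i2 := i1.sub (integrable_const (μ := μ) (LR * (hi * Γ) ^ 2 * α))
    have i3 := ((is k).sub (is (k + 1))).const_mul (DR * Γ)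
    refine (le_of_eq ?_).trans (integral_mono (i2.sub i3) (iq (k + 1)) hpath)
    rw [integral_sub' i2 i3, integral_sub' i1 (integrable_const _),
      integral_add' ((iq k).const_mul η) ((ig k).const_mul (1 - η)), integral_const_mul,
      integral_const_mul, integral_const_mul, integral_const_mul, integral_sub' (is k) (is (k + 1))]
    simp
  · exact ht.integral_estimated_descent_ge hP hn hB hγ₀.le hγ₁ hlo hhi hv₀ hβ hind k
  · exact ht.integral_merr_succ_le hP hn hB hγ₀.le hγ₁ rfl hδ₀ hδ₁ hα₀.le hlo hhi hη₀ hη₁.le hΓ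
      hv₀ hβ hind k
  · have : ∀ x : P.variant.Idx → ℝ, diag x (0 : P.Param) = 0 := fun x => by
      ext l; simp [diag]
    simp [ht.h_zero, this]
  · refine (integral_mono (iq T) (integrable_const (DR * (hi * Γ))) fun ω => ?_).trans
      (by simp)
    exact (real_inner_le_norm _ _).trans
      (mul_le_mul (hR.norm_gradient_le _) (hz ω T) (norm_nonneg _) hDR₀)
  · rw [← integral_sub (ir 0) (ir T)]
    refine (integral_mono ((ir 0).sub (ir T)) (integrable_const Δ) fun ω => ?_).trans (by simp)
    simp only [Pi.sub_apply, ht.w_zero]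
    exact hΔ _
  · rw [← integral_sub (is 0) (is T)]
    refine (integral_mono ((is 0).sub (is T)) (integrable_const Θ) fun ω => ?_).trans (by simp)
    exact ht.mass _ (hval ω) T
  · have : Nonempty (Fin n) := ⟨⟨0, hn⟩⟩
    refine (integral_mono (ie 0) (integrable_const (8 * K ^ 2)) fun ω => ?_).trans (by simp)
    exact mean_le Finset.univ_nonempty fun i _ =>
      hP.err_le (ht.a_zero _) (ht.b_zero _) _ i
  · exact integral_nonneg fun ω => by
      simp only [merr, mean, err, Pi.zero_apply]
      positivity

end Problem.IsTrajectory

/-! ### SGD and AMSGrad runs as trajectories. -/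

lemma Variant.card_idx_le {df dc : ℕ} (s : Variant df dc) : Fintype.card s.Idx ≤ df + dc := by
  cases s with
  | raan wf =>
    change Fintype.card (Fin dc) ≤ _
    simp
  | rlraan =>
    change Fintype.card (Fin df ⊕ Fin dc) ≤ _
    simp

namespace Problem

variable {𝒳 : Type*} {df dc m C A n : ℕ} {P : Problem 𝒳 df dc m C A n} {K D L c : ℝ}

namespace Good

/-- Indices outside the neighbourhood contribute the zero function, so no validity of `S` is
required. This lets `estG_eq` hold for every batch. -/
lemma differentiable_phat (hP : P.Good K D L c) (i : Fin n) (S : Finset (Fin n)) :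
    Differentiable ℝ (P.phat i S) := fun _ =>
  (hasFDerivAt_mean fun j _ => by
    by_cases hj : j ∈ P.nbr i
    · exact (hP.pw_smooth i j hj).diff _
    · have : P.pw i j = fun _ => 0 := funext fun w => if_neg hj
      rw [this]
      exact differentiableAt_const _).differentiableAt

lemma differentiable_qhat (hP : P.Good K D L c) (i : Fin n) (S : Finset (Fin n)) :
    Differentiable ℝ (P.qhat i S) := fun _ =>
  (hasFDerivAt_mean fun j _ => by
    by_cases hj : j ∈ P.nbr i
    · exact (hP.qw_smooth i j hj).diff _
    · have : P.qw i j = fun _ => 0 := funext fun w => if_neg hj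
      rw [this]
      exact differentiableAt_const _).differentiableAt

/-- The gradients scale like `P.scale` and the weights like its inverse, so the estimator is
invariant under normalization. -/
lemma estG_eq (hP : P.Good K D L c) (hn : 0 < n) (β : Batch n) (w : P.Param)
    (u : Fin n → EuclideanSpace ℝ (Fin 2)) :
    P.estG β w u = P.gest β w (fun i => u i 0 / P.scale) (fun i => u i 1 / P.scale) := by
  have hκ := (P.scale_pos hn).ne'
  have hgrad : ∀ f : P.Param → ℝ, Differentiable ℝ f →
      gradient (fun w' => P.scale * f w') w = P.scale • gradient f w := fun f hf => by
    rw [gradient, gradient, fderiv_const_mul (hf w), map_smul]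
  unfold estG gest
  congr 1
  refine Finset.sum_congr rfl fun i _ => ?_
  simp only [ghat_zero, ghat_one]
  rw [hgrad _ (hP.differentiable_phat i _), hgrad _ (hP.differentiable_qhat i _), smul_smul,
    smul_smul]
  have e1 : 1 / u i 1 * P.scale = 1 / (u i 1 / P.scale) := by
    rw [one_div_div, one_div, div_eq_inv_mul]
  have e2 : -(u i 0) / (u i 1) ^ 2 * P.scale
      = -(u i 0 / P.scale) / (u i 1 / P.scale) ^ 2 := by
    -- For an arbitrary `u` the denominator may vanish; both sides are then zero by the convention
    -- for division.
    rcases eq_or_ne (u i 1) 0 with h | h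
    · simp [h]
    · field_simp
  rw [e1, e2]

end Good

lemma updateU_zero_div (hn : 0 < n) (γ u₀ : ℝ) (β : Batch n) (w : P.Param)
    (u : Fin n → EuclideanSpace ℝ (Fin 2)) :
    (fun i => P.updateU γ u₀ β w u i 0 / P.scale)
      = P.upA γ β w (fun i => u i 0 / P.scale) := by
  have hκ := (P.scale_pos hn).ne'
  funext i
  unfold updateU upA
  split_ifs
  · simp only [Matrix.cons_val_zero, ghat_zero]
    field_simp
  · rfl

lemma updateU_one_div (hn : 0 < n) (γ u₀ : ℝ) (β : Batch n) (w : P.Param)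
    (u : Fin n → EuclideanSpace ℝ (Fin 2)) :
    (fun i => P.updateU γ u₀ β w u i 1 / P.scale)
      = P.upB γ (u₀ / P.scale) β w (fun i => u i 1 / P.scale) := by
  have hκ := P.scale_pos hn
  funext i
  unfold updateU upB
  split_ifs
  · simp only [Matrix.cons_val_one, Matrix.cons_val_fin_one, ghat_one]
    rw [← max_div_div_right hκ.le]
    congr 1
    field_simp
  · rfl

lemma run_u_succ (rule : UpdateRule) (α γ u₀ : ℝ) (w₁ v₁ : P.Param) (S : Fin n → Finset (Fin n))
    (β : ℕ → Batch n) (k : ℕ) :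
    (P.run rule α γ u₀ w₁ v₁ S β (k + 1)).u = P.updateU γ u₀ (β k)
      (P.run rule α γ u₀ w₁ v₁ S β k).w (P.run rule α γ u₀ w₁ v₁ S β k).u := by
  cases rule <;> rfl

lemma run_dependsOn (rule : UpdateRule) (α γ u₀ : ℝ) (w₁ v₁ : P.Param)
    (S : Fin n → Finset (Fin n)) (k : ℕ) :
    DependsOn (fun β => P.run rule α γ u₀ w₁ v₁ S β k) (Set.Iio k) := by
  induction k with
  | zero => exact fun _ _ _ => rfl
  | succ k ih =>
    intro β β' hβ
    have h : P.run rule α γ u₀ w₁ v₁ S β k = P.run rule α γ u₀ w₁ v₁ S β' k :=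
      ih fun i hi => hβ i (Nat.lt_succ_of_lt hi)
    simp only [run, h, hβ k (Nat.lt_succ_self k)]

lemma run_isTracking (hP : P.Good K D L c) (hn : 0 < n) (rule : UpdateRule) (α γ u₀ : ℝ)
    (w₁ v₁ : P.Param) {S : Fin n → Finset (Fin n)} (hS : ∀ i, S i ⊆ P.nbr i ∧ (S i).Nonempty) :
    P.IsTracking K c γ (u₀ / P.scale) (fun k β => (P.run rule α γ u₀ w₁ v₁ S β k).w)
      (fun k β i => (P.run rule α γ u₀ w₁ v₁ S β k).u i 0 / P.scale)
      (fun k β i => (P.run rule α γ u₀ w₁ v₁ S β k).u i 1 / P.scale) := by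
  have hκ := (P.scale_pos hn).ne'
  refine ⟨fun β i => ?_, fun β i => ?_, fun β i => ?_, fun k β => ?_, fun k β => ?_⟩
  · simp only [run, ghat_zero, mul_div_cancel_left₀ _ hκ]
    exact hP.abs_phat_le (hS i).1 (hS i).2 w₁
  · simp only [run, ghat_one, mul_div_cancel_left₀ _ hκ]
    exact hP.abs_qhat_le (hS i).1 (hS i).2 w₁
  · simp only [run, ghat_one, mul_div_cancel_left₀ _ hκ]
    exact hP.le_qhat (hS i).1 (hS i).2 w₁
  · simp only [run_u_succ]
    exact updateU_zero_div hn _ _ _ _ _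
  · simp only [run_u_succ]
    exact updateU_one_div hn _ _ _ _ _

/-- The gradient estimators of an SGD run, viewed as a momentum with parameter `0`. -/
def sgdMomentum (P : Problem 𝒳 df dc m C A n) (α γ u₀ : ℝ) (w₁ v₁ : P.Param)
    (S : Fin n → Finset (Fin n)) : ℕ → (ℕ → Batch n) → P.Param
  | 0, _ => 0
  | k + 1, β => P.estG (β k) (P.run .sgd α γ u₀ w₁ v₁ S β k).w
      (P.run .sgd α γ u₀ w₁ v₁ S β (k + 1)).u

/-- With momentum parameter `0` the momentum is the current estimator. The constant preconditioner
`1` loses no mass, so `Θ = 0` and no dimension enters the constant. -/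
lemma sgd_isTrajectory (hP : P.Good K D L c) (hn : 0 < n) (α γ u₀ : ℝ)
    (w₁ v₁ : P.Param) {S : Fin n → Finset (Fin n)} (hS : ∀ i, S i ⊆ P.nbr i ∧ (S i).Nonempty) :
    P.IsTrajectory K c α γ (u₀ / P.scale) 0 1 1 0 w₁
      (fun k β => (P.run .sgd α γ u₀ w₁ v₁ S β k).w) (P.sgdMomentum α γ u₀ w₁ v₁ S)
      (fun _ _ _ => 1)
      (fun k β i => (P.run .sgd α γ u₀ w₁ v₁ S β k).u i 0 / P.scale)
      (fun k β i => (P.run .sgd α γ u₀ w₁ v₁ S β k).u i 1 / P.scale) := by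
  have hdep := P.run_dependsOn .sgd α γ u₀ w₁ v₁ S
  refine ⟨run_isTracking hP hn .sgd α γ u₀ w₁ v₁ hS, ?_, ?_, ?_, ?_, ?_, ?_, ?_, ?_,
    ?_, ?_, ?_, ?_, ?_⟩
  · exact fun k β β' h => congrArg State.w (hdep k h)
  · intro k β β' h
    cases k with
    | zero => rfl
    | succ k =>
      have h1 : P.run .sgd α γ u₀ w₁ v₁ S β k = P.run .sgd α γ u₀ w₁ v₁ S β' k :=
        hdep k fun i hi => h i (Nat.lt_succ_of_lt hi)
      have h2 : P.run .sgd α γ u₀ w₁ v₁ S β (k + 1) = P.run .sgd α γ u₀ w₁ v₁ S β' (k + 1) :=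
        hdep (k + 1) h
      simp only [sgdMomentum, h1, h2, h k (Nat.lt_succ_self k)]
  · exact fun k β β' h => rfl
  · intro k β β' h
    have h1 : P.run .sgd α γ u₀ w₁ v₁ S β k = P.run .sgd α γ u₀ w₁ v₁ S β' k := hdep k h
    simp only [h1]
  · intro k β β' h
    have h1 : P.run .sgd α γ u₀ w₁ v₁ S β k = P.run .sgd α γ u₀ w₁ v₁ S β' k := hdep k h
    simp only [h1]
  · exact fun β => rfl
  · exact fun β => rfl
  · intro k β
    rw [zero_smul, zero_add, sub_zero, one_smul, sgdMomentum, hP.estG_eq hn]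
  · intro k β
    have : ∀ x : P.Param, diag (fun _ => 1) x = x := fun x => by ext l; simp [diag]
    rw [this]
    rfl
  · exact fun β _ k l => le_rfl
  · exact fun β _ k l => le_rfl
  · exact fun β _ k l => le_rfl
  · intro β _ k
    simp

/-- Lower bound for the AMSGrad preconditioner. -/
def amsgradLower (K D c ε b₁ : ℝ) : ℝ := 1 / √(ε + max b₁ (gradBound K D c ^ 2))

/-- The running maximum makes `v` nondecreasing, hence the preconditioner nonincreasing.
Nonnegativity of `v` bounds it above by `1 / √ε`, and the uniform bound on the estimator bounds it
below. Its trace is at most the dimension times `1 / √ε`, which is where the dimension enters. -/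
lemma amsgrad_isTrajectory (hP : P.Good K D L c) (hn : 0 < n) {α γ η₁ η₂ ε b₁ : ℝ} (u₀ : ℝ)
    (hγ₀ : 0 ≤ γ) (hγ₁ : γ ≤ 1) (hη₂ : 0 ≤ η₂) (hη₂' : η₂ ≤ 1) (hε : 0 < ε)
    (w₁ v₁ : P.Param) (hv₁ : ∀ l, 0 ≤ v₁ l ∧ v₁ l ≤ b₁)
    {S : Fin n → Finset (Fin n)} (hS : ∀ i, S i ⊆ P.nbr i ∧ (S i).Nonempty) :
    P.IsTrajectory K c α γ (u₀ / P.scale) η₁ (amsgradLower K D c ε b₁) (1 / √ε)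
      ((df + dc : ℕ) * (1 / √ε)) w₁
      (fun k β => (P.run (.amsgrad η₁ η₂ ε) α γ u₀ w₁ v₁ S β k).w)
      (fun k β => (P.run (.amsgrad η₁ η₂ ε) α γ u₀ w₁ v₁ S β k).h)
      (fun k β l => 1 / √(ε + (P.run (.amsgrad η₁ η₂ ε) α γ u₀ w₁ v₁ S β k).v l))
      (fun k β i => (P.run (.amsgrad η₁ η₂ ε) α γ u₀ w₁ v₁ S β k).u i 0 / P.scale)
      (fun k β i => (P.run (.amsgrad η₁ η₂ ε) α γ u₀ w₁ v₁ S β k).u i 1 / P.scale) := by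
  have hdep := P.run_dependsOn (.amsgrad η₁ η₂ ε) α γ u₀ w₁ v₁ S
  have htr := run_isTracking hP hn (.amsgrad η₁ η₂ ε) α γ u₀ w₁ v₁ hS
  have hvsucc : ∀ β k l, (P.run (.amsgrad η₁ η₂ ε) α γ u₀ w₁ v₁ S β (k + 1)).v l
      = max ((P.run (.amsgrad η₁ η₂ ε) α γ u₀ w₁ v₁ S β k).v l)
        (η₂ * (P.run (.amsgrad η₁ η₂ ε) α γ u₀ w₁ v₁ S β k).v l + (1 - η₂) *
          (P.estG (β k) (P.run (.amsgrad η₁ η₂ ε) α γ u₀ w₁ v₁ S β k).w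
            (P.run (.amsgrad η₁ η₂ ε) α γ u₀ w₁ v₁ S β (k + 1)).u l) ^ 2) := fun β k l => rfl
  have hvnonneg : ∀ β k l, 0 ≤ (P.run (.amsgrad η₁ η₂ ε) α γ u₀ w₁ v₁ S β k).v l := by
    intro β k l
    induction k with
    | zero => exact (hv₁ l).1
    | succ k ih => rw [hvsucc]; exact le_max_of_le_left ih
  have hvle : ∀ β, (∀ k, P.Valid (β k)) → ∀ k l,
      (P.run (.amsgrad η₁ η₂ ε) α γ u₀ w₁ v₁ S β k).v l ≤ max b₁ (gradBound K D c ^ 2) := by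
    intro β hβ k l
    induction k with
    | zero => exact le_max_of_le_left (hv₁ l).2
    | succ k ih =>
      rw [hvsucc]
      refine max_le ih ?_
      have hG := htr.norm_gest_le hP hγ₀ hγ₁ hβ k
      rw [← hP.estG_eq hn] at hG
      set G := P.estG (β k) (P.run (.amsgrad η₁ η₂ ε) α γ u₀ w₁ v₁ S β k).w
        (P.run (.amsgrad η₁ η₂ ε) α γ u₀ w₁ v₁ S β (k + 1)).u
      have h1 : (G l) ^ 2 ≤ max b₁ (gradBound K D c ^ 2) := by
        refine le_max_of_le_right ?_
        rw [← sq_abs]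
        exact pow_le_pow_left₀ (abs_nonneg _) ((PiLp.norm_apply_le G l).trans hG) 2
      -- The new second moment is a convex combination of two numbers below the bound.
      nlinarith [mul_le_mul_of_nonneg_left ih hη₂,
        mul_le_mul_of_nonneg_left h1 (sub_nonneg.2 hη₂')]
  have hd₀ : ∀ β k l, 1 / √(ε + (P.run (.amsgrad η₁ η₂ ε) α γ u₀ w₁ v₁ S β k).v l) ≤ 1 / √ε :=
    fun β k l => by
      have := hvnonneg β k l
      gcongr
      linarith
  refine ⟨htr, ?_, ?_, ?_, ?_, ?_, ?_, ?_, ?_, ?_, ?_, ?_, ?_, ?_⟩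
  · exact fun k β β' h => congrArg State.w (hdep k h)
  · exact fun k β β' h => congrArg State.h (hdep k h)
  · intro k β β' h
    have h1 : P.run (.amsgrad η₁ η₂ ε) α γ u₀ w₁ v₁ S β k
      = P.run (.amsgrad η₁ η₂ ε) α γ u₀ w₁ v₁ S β' k := hdep k h
    simp only [h1]
  · intro k β β' h
    have h1 : P.run (.amsgrad η₁ η₂ ε) α γ u₀ w₁ v₁ S β k
      = P.run (.amsgrad η₁ η₂ ε) α γ u₀ w₁ v₁ S β' k := hdep k h
    simp only [h1]
  · intro k β β' h
    have h1 : P.run (.amsgrad η₁ η₂ ε) α γ u₀ w₁ v₁ S β k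
      = P.run (.amsgrad η₁ η₂ ε) α γ u₀ w₁ v₁ S β' k := hdep k h
    simp only [h1]
  · exact fun β => rfl
  · exact fun β => rfl
  · intro k β
    rw [← hP.estG_eq hn]
    rfl
  · intro k β
    have e : ∀ h' v' : P.Param, (WithLp.toLp 2 fun l => h' l / √(ε + v' l) : P.Param)
        = diag (fun l => 1 / √(ε + v' l)) h' := fun h' v' => by
      ext l
      simp only [diag]
      ring
    exact congrArg (fun z => (P.run (.amsgrad η₁ η₂ ε) α γ u₀ w₁ v₁ S β k).w - α • z) (e _ _)
  · intro β hβ k l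
    have h1 := hvle β hβ k l
    have h2 := hvnonneg β k l
    unfold amsgradLower
    gcongr
  · exact fun β _ k l => hd₀ β k l
  · intro β hβ k l
    have h2 := hvnonneg β k l
    have h3 : (P.run (.amsgrad η₁ η₂ ε) α γ u₀ w₁ v₁ S β k).v l
        ≤ (P.run (.amsgrad η₁ η₂ ε) α γ u₀ w₁ v₁ S β (k + 1)).v l := by
      rw [hvsucc]; exact le_max_left _ _
    gcongr
  · intro β hβ k
    have h1 : ∑ l, 1 / √(ε + (P.run (.amsgrad η₁ η₂ ε) α γ u₀ w₁ v₁ S β 0).v l)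
        ≤ (df + dc : ℕ) * (1 / √ε) := by
      refine (Finset.sum_le_card_nsmul _ _ _ fun l _ => hd₀ β 0 l).trans ?_
      rw [nsmul_eq_mul, Finset.card_univ]
      gcongr
      exact P.variant.card_idx_le
    have h2 : 0 ≤ ∑ l, 1 / √(ε + (P.run (.amsgrad η₁ η₂ ε) α γ u₀ w₁ v₁ S β k).v l) :=
      Finset.sum_nonneg fun l _ => by positivity
    linarith

lemma le_qhat_of_le_g (hn : 0 < n) {u₀ : ℝ} (h : ∀ i w, u₀ ≤ P.g i w 1) (i : Fin n)
    (w : P.Param) : u₀ / P.scale ≤ P.qhat i (P.nbr i) w := by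
  rw [div_le_iff₀' (P.scale_pos hn), ← ghat_one]
  exact h i w

lemma IsUniformBatch.pos {Ω : Type*} [MeasurableSpace Ω] {μ : Measure Ω} [IsProbabilityMeasure μ]
    {B : ℕ} {β : Ω → Batch n} (h : P.IsUniformBatch μ B β) (hB : 0 < B) : 0 < n :=
  hB.trans_le h.le_card

end Problem

end

theorem theorem1 :
    -- SGD-style updates
    (∀ (Δ₁ M τ₀ : ℝ) (Cl Ll Cs Ls : ℝ≥0), 0 < τ₀ →
      ∃ K : ℝ, ∀ (𝒳 : Type*) (df dc m C A n : ℕ) (P : Problem 𝒳 df dc m C A n)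
        (w₁ v₁ : P.Param) (V u₀ : ℝ) (S : Fin n → Finset (Fin n)) (T B : ℕ)
        (Ω : Type*) (_ : MeasurableSpace Ω) (μ : Measure Ω) (_ : IsProbabilityMeasure μ)
        (β : ℕ → Ω → Batch n),
        n < T → 0 < B → τ₀ ≤ P.τ →
        P.Assumption w₁ Δ₁ M Cl Ll V → P.Regular Cs Ls →
        0 < u₀ → (∀ i w, u₀ ≤ P.g i w 1) →
        (∀ i, S i ⊆ P.nbr i ∧ (S i).Nonempty) →
        (∀ k, P.IsUniformBatch μ B (β k)) → iIndepFun β μ →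
        Integrable (fun ω => P.avgSqGrad .sgd u₀ w₁ v₁ S T (fun k => β k ω)) μ ∧
        ∫ ω, P.avgSqGrad .sgd u₀ w₁ v₁ S T (fun k => β k ω) ∂μ
          ≤ K * ((n : ℝ) ^ (2 / 5 : ℝ) / (T : ℝ) ^ (2 / 5 : ℝ))) ∧
    -- AMSGrad-style updates
    (∀ (Δ₁ M τ₀ : ℝ) (Cl Ll Cs Ls : ℝ≥0) (η₁ η₂ ε b₁ : ℝ) (df dc : ℕ), 0 < τ₀ →
      0 ≤ η₁ → η₁ < 1 → 0 ≤ η₂ → η₁ ≤ √η₂ → √η₂ ≤ 1 → 0 < ε →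
      ∃ K : ℝ, ∀ (𝒳 : Type*) (m C A n : ℕ) (P : Problem 𝒳 df dc m C A n)
        (w₁ v₁ : P.Param) (V u₀ : ℝ) (S : Fin n → Finset (Fin n)) (T B : ℕ)
        (Ω : Type*) (_ : MeasurableSpace Ω) (μ : Measure Ω) (_ : IsProbabilityMeasure μ)
        (β : ℕ → Ω → Batch n),
        n < T → 0 < B → τ₀ ≤ P.τ →
        P.Assumption w₁ Δ₁ M Cl Ll V → P.Regular Cs Ls →
        0 < u₀ → (∀ i w, u₀ ≤ P.g i w 1) →
        (∀ i, S i ⊆ P.nbr i ∧ (S i).Nonempty) →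
        (∀ l, 0 ≤ v₁ l ∧ v₁ l ≤ b₁) →
        (∀ k, P.IsUniformBatch μ B (β k)) → iIndepFun β μ →
        Integrable (fun ω => P.avgSqGrad (.amsgrad η₁ η₂ ε) u₀ w₁ v₁ S T (fun k => β k ω)) μ ∧
        ∫ ω, P.avgSqGrad (.amsgrad η₁ η₂ ε) u₀ w₁ v₁ S T (fun k => β k ω) ∂μ
          ≤ K * ((n : ℝ) ^ (2 / 5 : ℝ) / (T : ℝ) ^ (2 / 5 : ℝ))) := by
  constructor
  · intro Δ₁ M τ₀ Cl Ll Cs Ls hτ₀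
    obtain ⟨K, D, L, c, hgood⟩ := exists_good M τ₀ Cl Ll Cs Ls hτ₀
    -- The arguments `1 1 0 0` are the bounds `lo = hi = 1`, mass `Θ = 0` and momentum `η = 0` of
    -- the SGD trajectory.
    refine ⟨Problem.rateConst K D L c 1 1 0 0 Δ₁, ?_⟩
    intro 𝒳 df dc m C A n P w₁ v₁ V u₀ S T B Ω _ μ _ β hT hB hτ hA hR _ hu hS hβ hind
    have hP := hgood P w₁ Δ₁ V hτ hA hR
    have hn := (hβ 0).pos hB
    have ht := Problem.sgd_isTrajectory hP hn
      (1 / ((n : ℝ) ^ (2 / 5 : ℝ) * (T : ℝ) ^ (3 / 5 : ℝ)))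
      ((n : ℝ) ^ (2 / 5 : ℝ) / (T : ℝ) ^ (2 / 5 : ℝ)) u₀ w₁ v₁ hS
    exact ⟨ht.integrable_average (fun k => (hβ k).measurable) T,
      ht.integral_average_le hP hT hB rfl rfl one_pos zero_le_one le_rfl one_pos le_rfl hA.gap
        (Problem.le_qhat_of_le_g hn hu) hβ hind⟩
  · intro Δ₁ M τ₀ Cl Ll Cs Ls η₁ η₂ ε b₁ df dc hτ₀ hη₁ hη₁' hη₂ _ hη₂' hε
    obtain ⟨K, D, L, c, hgood⟩ := exists_good M τ₀ Cl Ll Cs Ls hτ₀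
    refine ⟨Problem.rateConst K D L c (Problem.amsgradLower K D c ε b₁) (1 / √ε)
      ((df + dc : ℕ) * (1 / √ε)) η₁ Δ₁, ?_⟩
    intro 𝒳 m C A n P w₁ v₁ V u₀ S T B Ω _ μ _ β hT hB hτ hA hR _ hu hS hv₁ hβ hind
    have hP := hgood P w₁ Δ₁ V hτ hA hR
    have hn := (hβ 0).pos hB
    obtain ⟨-, hγ₀, hγ₁, -⟩ := step_size_bounds hB (hβ 0).le_card hT rfl rfl rfl rfl
    have ht := Problem.amsgrad_isTrajectory hP hn
      (α := 1 / ((n : ℝ) ^ (2 / 5 : ℝ) * (T : ℝ) ^ (3 / 5 : ℝ))) (η₁ := η₁) u₀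
      hγ₀.le hγ₁ hη₂ (Real.sqrt_le_one.1 hη₂') hε w₁ v₁ hv₁ hS
    have hlo : 0 < Problem.amsgradLower K D c ε b₁ := by
      have : 0 ≤ max b₁ (Problem.gradBound K D c ^ 2) := le_max_of_le_right (sq_nonneg _)
      unfold Problem.amsgradLower
      positivity
    exact ⟨ht.integrable_average (fun k => (hβ k).measurable) T,
      ht.integral_average_le hP hT hB rfl rfl hlo (by positivity) hη₁ hη₁' (by positivity) hA.gap
        (Problem.le_qhat_of_le_g hn hu) hβ hind⟩
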